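/- Let $d\ge 1$. For measurable $F:\mathbb{R}^d\to\mathbb{C}$, say that $F$ is the Fourier transform $\widehat f$ of a function $f$ on $\mathbb{R}^d$ (in the sense of tempered distributions, normalized as $\widehat f(\xi)=\int_{\mathbb{R}^d} f(x)e^{2i\pi\langle x,\xi\rangle}\,dx$) if, for every Schwartz function $\varphi$ with (classical) transform $\widehat\varphi(x)=\int_{\mathbb{R}^d}\varphi(\xi)e^{2i\pi\langle x,\xi\rangle}\,d\xi$, the functions $f\widehat\varphi$ and $F\varphi$ are integrable and $\int_{\mathbb{R}^d} f\,\widehat\varphi=\int_{\mathbb{R}^d} F\,\varphi$. Say that $f$ has spectrum in a measurable set $\Sigma\subset\mathbb{R}^d$ if its Fourier transform is a function $\widehat f\in L^s(\mathbb{R}^d)$, for some $s\in[1,\infty]$, that vanishes almost everywhere on $\mathbb{R}^d\setminus\Sigma$. (If $f\in L^p$ with $1\le p\le 2$, then $\widehat f\in L^{p'}$ automatically, by the Hausdorff–Young theorem.) There is a constant $C=C(d)>0$, depending only on $d$, such that for all Lebesgue measurable sets $S,\Sigma\subset\mathbb{R}^d$ with $|S||\Sigma|<\infty$ (where $0\cdot\infty=0$),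 for every $p\in(0,2)$ and for every $f\in L^p(\mathbb{R}^d)$ with spectrum in $\Sigma$, $$ \int_{\mathbb{R}^d}|f(x)|^p\,dx\;\le\; C\,e^{Cp|S||\Sigma|}\int_{\mathbb{R}^d\setminus S}|f(x)|^p\,dx . $$ -/

import Mathlib

open MeasureTheory
open scoped FourierTransform SchwartzMap ENNReal

/-- `F` is the Fourier transform of the function `f` on `ℝ^d`, in the sense of tempered
distributions and with the normalization `∫ f(x) e^{2iπ⟨x,ξ⟩} dx`. Both `f` and `F` are integrable
against every Schwartz function, and `∫ f φ̂ = ∫ F φ` for every Schwartz function `φ`, where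
`φ̂(x) = ∫ φ(ξ) e^{2iπ⟨x,ξ⟩} dξ`; with this sign in the exponent, `φ̂` is `𝓕⁻ φ` in Mathlib. -/
def IsFourierTransform {d : ℕ} (f F : EuclideanSpace ℝ (Fin d) → ℂ) : Prop :=
  ∀ φ : 𝓢(EuclideanSpace ℝ (Fin d), ℂ),
    Integrable (fun x => f x * (𝓕⁻ φ : 𝓢(EuclideanSpace ℝ (Fin d), ℂ)) x) volume ∧
    Integrable (fun ξ => F ξ * φ ξ) volume ∧
    ∫ x, f x * (𝓕⁻ φ : 𝓢(EuclideanSpace ℝ (Fin d), ℂ)) x = ∫ ξ, F ξ * φ ξ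

/-- `f` has spectrum in the set `Sig`: its Fourier transform is a function, belonging to some
Lebesgue space `L^s` with `1 ≤ s ≤ ∞`, that vanishes almost everywhere outside `Sig`.
(For `f ∈ L^p` with `1 ≤ p ≤ 2` the Fourier transform is in `L^{p'}` by Hausdorff-Young.) -/
def HasSpectrumIn {d : ℕ} (f : EuclideanSpace ℝ (Fin d) → ℂ)
    (Sig : Set (EuclideanSpace ℝ (Fin d))) : Prop :=
  ∃ F : EuclideanSpace ℝ (Fin d) → ℂ,
    (∃ s : ℝ≥0∞, 1 ≤ s ∧ MemLp F s volume) ∧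
    IsFourierTransform f F ∧
    ∀ᵐ ξ ∂volume, ξ ∉ Sig → F ξ = 0

/-! The case $|S|=0$ is trivial. Otherwise $|\Sigma|<\infty$, so $\widehat f=F$ is integrable and
$f$ may be replaced by the continuous function `𝓕 F`. Its values on a translate $y+\Lambda$ of a
lattice are Fourier coefficients of a periodization of $F$ times a phase. When $\Lambda$ is scaled
by $|\Sigma|^{-1/d}$, with a small constant, the image of $\Sigma$ fills less than half of the
torus, so the periodization vanishes on a closed set $E$ of measure at least $1/2$.

Let $N$ consist of the index of $y$ and of the indices of lattice points in $S$. On $E$ the part of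
the Fourier series with frequencies in $N$ is the negative of the rest. A Turán–Nazarov inequality
(`sq_norm_coeff_le_setIntegral`) then bounds $|f(y)|^2$ by $16\cdot 256^{|N|}$ times the sum of
$|f|^2$ over lattice points outside $S$ (`sq_enorm_coeff_zero_le_tsum`). Averaging over a random
lattice gives one for which $|N|\lesssim 1+|S||\Sigma|$ and this sum is
$\lesssim|\Sigma|\int_{S^c}|f|^2$. Hence a pointwise bound $|f(y)|^2\le
K|\Sigma|e^{K|S||\Sigma|}\int_{S^c}|f|^2$ (`exists_sq_enorm_fourier_le_setLIntegral`).

The Turán–Nazarov inequality must depend on the number of frequencies and not on their size. This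
comes from Mahler's inequality $M(p')\le \deg p\cdot M(p)$: differentiation removes a term, so
induction on the number of terms bounds every coefficient by $2^nM(p)$.

For $p<2$, the pointwise bound is applied to $S$ enlarged by the set where $|f|$ is large. Raising
it to the power $p/2$ puts the factor $p$ in the exponent (`setLIntegral_rpow_le_of_sq_le`). -/

/-! ### Mahler measure: the derivative inequality and coefficients of sparse polynomials -/

namespace Polynomial

/-- Reflection of the complement of the closed unit disc into the disc. -/
noncomputable def reflectIntoDisc (w : ℂ) : ℂ := if ‖w‖ ≤ 1 then w else (starRingEnd ℂ w)⁻¹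

lemma norm_reflectIntoDisc_le (w : ℂ) : ‖reflectIntoDisc w‖ ≤ 1 := by
  unfold reflectIntoDisc
  split_ifs with h
  · exact h
  · rw [norm_inv, RCLike.norm_conj]
    exact inv_le_one_of_one_le₀ (not_le.mp h).le

lemma norm_sub_eq_max_mul_norm_sub_reflectIntoDisc {z : ℂ} (hz : ‖z‖ = 1) (w : ℂ) :
    ‖z - w‖ = max 1 ‖w‖ * ‖z - reflectIntoDisc w‖ := by
  unfold reflectIntoDisc
  split_ifs with h
  · rw [max_eq_left h, one_mul]
  · have hw : w ≠ 0 := by rintro rfl; simp at h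
    have hw' : starRingEnd ℂ w ≠ 0 := by simpa using hw
    have hzz : z * starRingEnd ℂ z = 1 := by simp [Complex.mul_conj', hz]
    rw [max_eq_right (not_le.mp h).le]
    have h1 : ‖w‖ = ‖starRingEnd ℂ w‖ := (RCLike.norm_conj w).symm
    have h2 : ‖z - w‖ = ‖z‖ * ‖starRingEnd ℂ (z - w)‖ := by rw [RCLike.norm_conj, hz, one_mul]
    rw [h2, h1, ← norm_mul, ← norm_mul, ← norm_neg]
    congr 1
    rw [map_sub]
    field_simp
    linear_combination (-1 : ℂ) * hzz

/-- The map $w\mapsto z/(z-w)=1/(1-w/z)$ carries the closed disc to the half-plane $\mathrm{Re}\ge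
1/2$, and its exterior to the opposite one. -/
lemma half_le_re_div_sub {z w : ℂ} (hz : ‖z‖ = 1) (hw : ‖w‖ ≤ 1) (hzw : z ≠ w) :
    1 / 2 ≤ (z / (z - w)).re := by
  have hpos : 0 < Complex.normSq (z - w) := Complex.normSq_pos.mpr (sub_ne_zero.mpr hzw)
  have h1 : z.re * z.re + z.im * z.im = 1 := by
    rw [← Complex.normSq_apply, Complex.normSq_eq_norm_sq, hz, one_pow]
  have h2 : w.re * w.re + w.im * w.im ≤ 1 := by
    rw [← Complex.normSq_apply, Complex.normSq_eq_norm_sq]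
    exact pow_le_one₀ (norm_nonneg _) hw
  rw [Complex.div_re, ← add_div, le_div_iff₀ hpos, Complex.normSq_apply]
  simp only [Complex.sub_re, Complex.sub_im]
  nlinarith

lemma re_div_sub_le_half {z w : ℂ} (hz : ‖z‖ = 1) (hw : 1 ≤ ‖w‖) :
    (z / (z - w)).re ≤ 1 / 2 := by
  rcases eq_or_ne z w with rfl | hzw
  · simp
  have hpos : 0 < Complex.normSq (z - w) := Complex.normSq_pos.mpr (sub_ne_zero.mpr hzw)
  have h1 : z.re * z.re + z.im * z.im = 1 := by
    rw [← Complex.normSq_apply, Complex.normSq_eq_norm_sq, hz, one_pow]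
  have h2 : 1 ≤ w.re * w.re + w.im * w.im := by
    rw [← Complex.normSq_apply, Complex.normSq_eq_norm_sq]
    exact one_le_pow₀ hw
  rw [Complex.div_re, ← add_div, div_le_iff₀ hpos, Complex.normSq_apply]
  simp only [Complex.sub_re, Complex.sub_im]
  nlinarith

/-- Reflecting $w$ in the circle turns $v=z/(z-w)$ into $1-\bar v$: the imaginary part is kept and
the real part is mirrored at $1/2$. Real parts thus become positive and dominant, so they add
without cancellation over all roots. -/
lemma div_sub_reflectIntoDisc {z w : ℂ} (hz : ‖z‖ = 1) (hzw : z ≠ w) :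
    (z / (z - reflectIntoDisc w)).im = (z / (z - w)).im ∧
      |(z / (z - w)).re| ≤ (z / (z - reflectIntoDisc w)).re := by
  unfold reflectIntoDisc
  split_ifs with h
  · refine ⟨rfl, (abs_of_nonneg ?_).le⟩
    linarith [half_le_re_div_sub hz h hzw]
  · have hw : w ≠ 0 := by rintro rfl; simp at h
    have hw' : starRingEnd ℂ w ≠ 0 := by simpa using hw
    have hzz : z * starRingEnd ℂ z = 1 := by simp [Complex.mul_conj', hz]
    have hz0 : z ≠ 0 := by rintro rfl; simp at hz
    have hd : starRingEnd ℂ z - starRingEnd ℂ w ≠ 0 := by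
      rw [← map_sub]
      exact (_root_.map_ne_zero _).mpr (sub_ne_zero.mpr hzw)
    have hd' : z * starRingEnd ℂ w - 1 ≠ 0 := by
      intro h0
      apply hd
      apply mul_left_cancel₀ hz0
      linear_combination hzz - h0
    have key : z / (z - (starRingEnd ℂ w)⁻¹) = 1 - starRingEnd ℂ (z / (z - w)) := by
      rw [map_div₀, map_sub]
      have : z - (starRingEnd ℂ w)⁻¹ = (z * starRingEnd ℂ w - 1) / starRingEnd ℂ w := by
        field_simp
      rw [this, div_div_eq_mul_div, eq_sub_iff_add_eq, div_add_div _ _ hd' hd, div_eq_one_iff_eq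
        (mul_ne_zero hd' hd)]
      linear_combination (starRingEnd ℂ w) * hzz
    rw [key]
    have := re_div_sub_le_half hz (not_le.mp h).le
    constructor
    · simp only [Complex.sub_im, Complex.one_im, Complex.conj_im]
      ring
    · simp only [Complex.sub_re, Complex.one_re, Complex.conj_re]
      rw [abs_le]
      constructor <;> linarith

lemma norm_sum_div_sub_le_reflectIntoDisc {z : ℂ} (hz : ‖z‖ = 1) (s : Multiset ℂ) (hs : z ∉ s) :
    ‖(s.map fun w => 1 / (z - w)).sum‖ ≤
      ‖(s.map fun w => 1 / (z - reflectIntoDisc w)).sum‖ := by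
  have key : ((z * (s.map fun w => 1 / (z - reflectIntoDisc w)).sum).im =
        (z * (s.map fun w => 1 / (z - w)).sum).im) ∧
      |(z * (s.map fun w => 1 / (z - w)).sum).re| ≤
        (z * (s.map fun w => 1 / (z - reflectIntoDisc w)).sum).re := by
    induction s using Multiset.induction_on with
    | empty => simp
    | cons a s ih =>
      simp only [Multiset.mem_cons, not_or] at hs
      obtain ⟨h1, h2⟩ := ih hs.2
      obtain ⟨h3, h4⟩ := div_sub_reflectIntoDisc hz hs.1
      simp only [Multiset.map_cons, Multiset.sum_cons, mul_add, Complex.add_im, Complex.add_re,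
        mul_one_div]
      refine ⟨by rw [h1, h3], (abs_add_le _ _).trans (add_le_add h4 h2)⟩
  have hm (u : ℂ) : ‖u‖ = ‖z * u‖ := by rw [norm_mul, hz, one_mul]
  rw [hm, hm (Multiset.sum _)]
  rw [← sq_le_sq₀ (norm_nonneg _) (norm_nonneg _), ← Complex.normSq_eq_norm_sq,
    ← Complex.normSq_eq_norm_sq, Complex.normSq_apply, Complex.normSq_apply, key.1]
  have h5 := mul_self_le_mul_self (abs_nonneg _) key.2
  rw [abs_mul_abs_self] at h5
  linarith

/-- The polynomial with the same modulus on the unit circle as `p`, whose roots are the roots of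
`p` reflected into the closed unit disc. -/
noncomputable def reflectRoots (p : ℂ[X]) : ℂ[X] :=
  C (p.mahlerMeasure : ℂ) * ((p.roots.map reflectIntoDisc).map fun w => X - C w).prod

lemma roots_reflectRoots {p : ℂ[X]} (hp : p ≠ 0) :
    p.reflectRoots.roots = p.roots.map reflectIntoDisc := by
  rw [reflectRoots, roots_C_mul _ (by simpa using (mahlerMeasure_pos_of_ne_zero hp).ne'),
    roots_multiset_prod_X_sub_C]

lemma leadingCoeff_reflectRoots (p : ℂ[X]) :
    p.reflectRoots.leadingCoeff = p.mahlerMeasure := by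
  rw [reflectRoots, leadingCoeff_mul, leadingCoeff_C,
    (monic_multiset_prod_of_monic _ _ fun w _ => monic_X_sub_C w).leadingCoeff, mul_one]

lemma natDegree_reflectRoots {p : ℂ[X]} (hp : p ≠ 0) :
    p.reflectRoots.natDegree = p.natDegree := by
  rw [(IsAlgClosed.splits p.reflectRoots).natDegree_eq_card_roots,
    (IsAlgClosed.splits p).natDegree_eq_card_roots, roots_reflectRoots hp, Multiset.card_map]

lemma norm_eval_reflectRoots {z : ℂ} (hz : ‖z‖ = 1) (p : ℂ[X]) :
    ‖p.reflectRoots.eval z‖ = ‖p.eval z‖ := by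
  conv_rhs => rw [(IsAlgClosed.splits p).eq_prod_roots]
  rw [reflectRoots, mahlerMeasure_eq_leadingCoeff_mul_prod_roots]
  simp only [eval_mul, eval_C, norm_mul, Complex.norm_real, norm_norm, mul_assoc]
  congr 1
  induction p.roots using Multiset.induction_on with
  | empty => simp
  | cons a s ih =>
    simp only [Multiset.map_cons, Multiset.prod_cons, norm_mul, eval_mul, eval_sub, eval_X, eval_C,
      norm_sub_eq_max_mul_norm_sub_reflectIntoDisc hz a] at ih ⊢
    rw [← ih, Real.norm_of_nonneg (le_max_of_le_left zero_le_one)]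
    ring

/-- The logarithmic derivative is the sum of $1/(z-w)$ over the roots, and $|p|$ is unchanged on the
circle. -/
lemma norm_eval_derivative_le_reflectRoots {z : ℂ} (hz : ‖z‖ = 1) {p : ℂ[X]}
    (hpz : p.eval z ≠ 0) :
    ‖p.derivative.eval z‖ ≤ ‖p.reflectRoots.derivative.eval z‖ := by
  have hp : p ≠ 0 := by rintro rfl; simp at hpz
  have hn := norm_eval_reflectRoots hz p
  have hq : p.reflectRoots.eval z ≠ 0 := by
    rw [← norm_ne_zero_iff, hn]; exact norm_ne_zero_iff.mpr hpz
  have h1 := (IsAlgClosed.splits p).eval_derivative_div_eval_of_ne_zero hpz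
  have h2 := (IsAlgClosed.splits p.reflectRoots).eval_derivative_div_eval_of_ne_zero hq
  rw [roots_reflectRoots hp, Multiset.map_map] at h2
  have h3 := norm_sum_div_sub_le_reflectIntoDisc hz p.roots (fun h => hpz (mem_roots'.mp h).2)
  have h4 : ‖p.derivative.eval z / p.eval z‖ ≤
      ‖p.reflectRoots.derivative.eval z / p.reflectRoots.eval z‖ := by
    rw [h1, h2]; exact h3
  rw [norm_div, norm_div, hn] at h4
  exact (div_le_div_iff_of_pos_right (norm_pos_iff.mpr hpz)).mp h4

/-- By Gauss–Lucas the derivative has all its roots in the closed disc, so its Mahler measure is the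
modulus of its leading coefficient. -/
lemma mahlerMeasure_derivative_reflectRoots {p : ℂ[X]} (hp : 0 < p.natDegree) :
    p.reflectRoots.derivative.mahlerMeasure = p.natDegree * p.mahlerMeasure := by
  have hp0 : p ≠ 0 := by rintro rfl; simp at hp
  have hd := natDegree_reflectRoots hp0
  have hdeg : 0 < p.reflectRoots.degree := natDegree_pos_iff_degree_pos.mp (hd ▸ hp)
  rw [mahlerMeasure_eq_leadingCoeff_mul_prod_roots]
  have hroots : ∀ w ∈ p.reflectRoots.derivative.roots, ‖w‖ ≤ 1 := by
    intro w hw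
    have hsub := rootSet_derivative_subset_convexHull_rootSet hdeg
    have hw' : w ∈ p.reflectRoots.derivative.rootSet ℂ := by
      rw [mem_rootSet, coe_aeval_eq_eval]
      exact mem_roots'.mp hw
    have hball : convexHull ℝ (p.reflectRoots.rootSet ℂ) ⊆ Metric.closedBall 0 1 := by
      refine convexHull_min (fun v hv => ?_) (convex_closedBall _ _)
      rw [mem_rootSet, coe_aeval_eq_eval] at hv
      have hv' : v ∈ p.reflectRoots.roots := mem_roots'.mpr hv
      rw [roots_reflectRoots hp0, Multiset.mem_map] at hv'
      obtain ⟨u, -, rfl⟩ := hv'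
      simpa using norm_reflectIntoDisc_le u
    simpa using hball (hsub hw')
  have hprod : (p.reflectRoots.derivative.roots.map fun a => max 1 ‖a‖).prod = 1 := by
    rw [Multiset.map_congr rfl fun w hw => max_eq_left (hroots w hw)]
    simp
  rw [hprod, mul_one, leadingCoeff, natDegree_derivative, coeff_derivative, hd,
    Nat.sub_add_cancel hp]
  rw [← hd, coeff_natDegree, leadingCoeff_reflectRoots, hd, norm_mul, Complex.norm_real,
    Real.norm_of_nonneg (mahlerMeasure_nonneg p), mul_comm]
  congr 1
  rw [← Nat.cast_add_one, Nat.sub_add_cancel hp, Complex.norm_natCast]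

/-- **Mahler's inequality** for the derivative. -/
theorem mahlerMeasure_derivative_le (p : ℂ[X]) :
    p.derivative.mahlerMeasure ≤ p.natDegree * p.mahlerMeasure := by
  rcases Nat.eq_zero_or_pos p.natDegree with h | h
  · rw [natDegree_eq_zero] at h
    obtain ⟨c, rfl⟩ := h
    simp
  have hp0 : p ≠ 0 := by rintro rfl; simp at h
  have hd : p.derivative ≠ 0 := fun h0 => h.ne' (derivative_eq_zero.mp h0)
  rw [← mahlerMeasure_derivative_reflectRoots h]
  have hq : p.reflectRoots.derivative ≠ 0 := fun h0 =>
    h.ne' (natDegree_reflectRoots hp0 ▸ derivative_eq_zero.mp h0)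
  rw [mahlerMeasure_def_of_ne_zero hd, mahlerMeasure_def_of_ne_zero hq, Real.exp_le_exp]
  refine mul_le_mul_of_nonneg_left ?_ (by positivity)
  refine intervalIntegral.integral_mono_ae Real.two_pi_pos.le
    (intervalIntegrable_mahlerMeasure _) (intervalIntegrable_mahlerMeasure _) ?_
  have hfin : ((p * p.derivative).roots.toFinset : Set ℂ).Countable := Finset.countable_toSet _
  have hae := (hfin.preimage_circleMap 0 one_ne_zero).ae_notMem volume
  filter_upwards [hae] with t ht
  have ht' : (p * p.derivative).eval (circleMap 0 1 t) ≠ 0 := fun h0 => ht (by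
    simpa [mem_roots', mul_ne_zero hp0 hd, hp0, hd] using h0)
  rw [eval_mul, mul_ne_zero_iff] at ht'
  exact Real.log_le_log (norm_pos_iff.mpr ht'.2)
    (norm_eval_derivative_le_reflectRoots (by simp) ht'.1)

lemma mahlerMeasure_X : (X : ℂ[X]).mahlerMeasure = 1 := by
  simpa using mahlerMeasure_X_sub_C 0

lemma mahlerMeasure_X_pow (k : ℕ) : (X ^ k : ℂ[X]).mahlerMeasure = 1 := by
  induction k with
  | zero => simp
  | succ k ih => rw [pow_succ, mahlerMeasure_mul, ih, mahlerMeasure_X, one_mul]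

lemma mahlerMeasure_reverse (p : ℂ[X]) : p.reverse.mahlerMeasure = p.mahlerMeasure := by
  conv_lhs => rw [(IsAlgClosed.splits p).eq_prod_roots]
  conv_rhs => rw [(IsAlgClosed.splits p).eq_prod_roots]
  rw [reverse_mul_of_domain, mahlerMeasure_mul, mahlerMeasure_mul, reverse_C]
  congr 1
  induction p.roots using Multiset.induction_on with
  | empty => simp [← C_1, -map_one]
  | cons a s ih =>
    rw [Multiset.map_cons, Multiset.prod_cons, reverse_mul_of_domain, mahlerMeasure_mul,
      mahlerMeasure_mul, ih]
    congr 1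
    rcases eq_or_ne a 0 with rfl | ha
    · have : reverse (X : ℂ[X]) = 1 := by simpa [← C_1, -map_one] using reverse_X_mul (1 : ℂ[X])
      rw [C_0, sub_zero, this, mahlerMeasure_one, mahlerMeasure_X]
    · have : reverse (X - C a) = C (-a) * X + C 1 := by
        rw [sub_eq_add_neg, ← C_neg, reverse_add_C, natDegree_X, pow_one]
        have : reverse (X : ℂ[X]) = 1 := by simpa [← C_1, -map_one] using reverse_X_mul (1 : ℂ[X])
        rw [this, C_1, add_comm]
      rw [this, mahlerMeasure_C_mul_X_add_C (neg_ne_zero.mpr ha), mahlerMeasure_X_sub_C,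
        norm_neg, norm_one, max_comm]

lemma card_support_derivative_lt {p : ℂ[X]} (hp : p.coeff 0 ≠ 0) :
    p.derivative.support.card < p.support.card := by
  calc p.derivative.support.card ≤ (p.support.erase 0).card := by
        refine Finset.card_le_card_of_injOn (· + 1) (fun i hi => ?_) (by simp)
        simp only [Finset.mem_coe, mem_support_iff, coeff_derivative, Finset.mem_erase] at hi ⊢
        exact ⟨by simp, left_ne_zero_of_mul hi⟩
    _ < p.support.card := Finset.card_erase_lt_of_mem (mem_support_iff.mpr hp)

lemma card_support_reverse (p : ℂ[X]) : p.reverse.support.card = p.support.card := by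
  rw [reverse, reflect_support, Finset.card_image_of_injective _ (revAt p.natDegree).injective]

/-- A coefficient of a polynomial is controlled by the Mahler measure and the number of terms. -/
theorem norm_coeff_le_two_pow_mul_mahlerMeasure (n : ℕ) (p : ℂ[X]) (hn : p.support.card ≤ n + 1)
    (j : ℕ) : ‖p.coeff j‖ ≤ 2 ^ n * p.mahlerMeasure := by
  induction n generalizing p j with
  | zero =>
    obtain ⟨k, c, rfl⟩ := card_support_le_one_iff_monomial.mp hn
    rw [← C_mul_X_pow_eq_monomial, mahlerMeasure_mul]
    rw [mahlerMeasure_X_pow, mahlerMeasure_const, coeff_C_mul_X_pow]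
    split_ifs <;> simp
  | succ n ih =>
    -- For an index in the upper half, differentiation loses only $\deg q/i\le 2$, and it kills the
    -- constant term. Lower indices are moved to the upper half by reversing the polynomial.
    have upper (q : ℂ[X]) (hq : q.support.card ≤ n + 2) (h0 : q.coeff 0 ≠ 0) (i : ℕ)
        (hi : q.natDegree ≤ 2 * i) : ‖q.coeff i‖ ≤ 2 ^ (n + 1) * q.mahlerMeasure := by
      have hM := mahlerMeasure_nonneg q
      rcases Nat.eq_zero_or_pos i with rfl | hi0
      · have hl : q.coeff 0 = q.leadingCoeff := by
          rw [leadingCoeff, show q.natDegree = 0 by omega]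
        rw [hl]
        exact (leadingCoeff_le_mahlerMeasure q).trans
          (le_mul_of_one_le_left hM (one_le_pow₀ one_le_two))
      obtain ⟨i, rfl⟩ := Nat.exists_eq_add_of_lt hi0
      have h1 := ih q.derivative (by have := card_support_derivative_lt h0; omega) i
      have h2 := mahlerMeasure_derivative_le q
      rw [coeff_derivative, norm_mul, zero_add] at *
      have h3 : ‖(i : ℂ) + 1‖ = i + 1 := by exact_mod_cast Complex.norm_natCast (i + 1)
      rw [h3] at h1
      have h4 : (q.natDegree : ℝ) ≤ 2 * (i + 1) := by exact_mod_cast hi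
      have h5 : ‖q.coeff (i + 1)‖ * (i + 1) ≤ (2 ^ (n + 1) * q.mahlerMeasure) * (i + 1) :=
        calc _ ≤ 2 ^ n * q.derivative.mahlerMeasure := h1
          _ ≤ 2 ^ n * (2 * (i + 1) * q.mahlerMeasure) := by
            gcongr
            exact h2.trans (by gcongr)
          _ = _ := by ring
      exact le_of_mul_le_mul_right h5 (by positivity)
    rcases eq_or_ne (p.coeff j) 0 with hj | hj
    · rw [hj, norm_zero]
      exact mul_nonneg (by positivity) (mahlerMeasure_nonneg p)
    have hp : p ≠ 0 := by rintro rfl; simp at hj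
    have hjN : j ≤ p.natDegree := le_natDegree_of_ne_zero hj
    have hjm : p.natTrailingDegree ≤ j := natTrailingDegree_le_of_ne_zero hj
    have hc : p.reverse.coeff (p.natDegree - j) = p.coeff j := by
      rw [coeff_reverse, revAt_le (Nat.sub_le _ _), Nat.sub_sub_self hjN]
    -- `p` itself may be divisible by `X`; its reverse is not, so the alternatives are one reversal
    -- or two.
    have hq0 : p.reverse.coeff 0 ≠ 0 := by rwa [coeff_zero_reverse, leadingCoeff_ne_zero]
    have hqd := reverse_natDegree p
    rw [← hc, ← mahlerMeasure_reverse]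
    by_cases hcase : p.reverse.natDegree ≤ 2 * (p.natDegree - j)
    · exact upper _ (by rwa [card_support_reverse]) hq0 _ hcase
    · have hr0 : p.reverse.reverse.coeff 0 ≠ 0 := by
        rwa [coeff_zero_reverse, leadingCoeff_ne_zero, Ne, reverse_eq_zero]
      have hrd : p.reverse.reverse.natDegree = p.reverse.natDegree := by
        rw [reverse_natDegree, natTrailingDegree_reverse, Nat.sub_zero]
      have hle : p.natDegree - j ≤ p.reverse.natDegree := by omega
      have hc2 : p.reverse.reverse.coeff (p.reverse.natDegree - (p.natDegree - j)) =
          p.reverse.coeff (p.natDegree - j) := by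
        rw [coeff_reverse, revAt_le (Nat.sub_le _ _), Nat.sub_sub_self hle]
      rw [← hc2, ← mahlerMeasure_reverse]
      exact upper _ (by rwa [card_support_reverse, card_support_reverse]) hr0 _ (by omega)

end Polynomial

-- The Turán–Nazarov inequality on the torus

attribute [local instance] instMeasureSpaceUnitAddCircle
  instIsAddHaarMeasureUnitAddCircleVolume instIsProbabilityMeasureUnitAddCircleVolume

open Polynomial in
-- The shift by `ε` makes the logarithm continuous, so that averaging over the torus needs no care
-- at zeros.
lemma log_norm_coeff_le_average_log {n : ℕ} {p : ℂ[X]} (hn : p.support.card ≤ n) {j : ℕ}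
    (hj : p.coeff j ≠ 0) {ε : ℝ} (hε : 0 < ε) :
    Real.log ‖p.coeff j‖ - n * Real.log 2 ≤
      (2 * Real.pi)⁻¹ * ∫ θ in (0 : ℝ)..2 * Real.pi,
        Real.log (‖p.eval (circleMap 0 1 θ)‖ + ε) := by
  have hp : p ≠ 0 := by rintro rfl; simp at hj
  have h1 := norm_coeff_le_two_pow_mul_mahlerMeasure n p (by omega) j
  have h2 := Real.log_le_log (norm_pos_iff.mpr hj) h1
  rw [Real.log_mul (by positivity) (mahlerMeasure_pos_of_ne_zero hp).ne', Real.log_pow,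
    ← logMahlerMeasure_eq_log_MahlerMeasure] at h2
  have h3 : p.logMahlerMeasure ≤ (2 * Real.pi)⁻¹ * ∫ θ in (0 : ℝ)..2 * Real.pi,
        Real.log (‖p.eval (circleMap 0 1 θ)‖ + ε) := by
    refine mul_le_mul_of_nonneg_left ?_ (by positivity)
    refine intervalIntegral.integral_mono_ae Real.two_pi_pos.le
      (intervalIntegrable_mahlerMeasure _) (Continuous.intervalIntegrable ?_ _ _) ?_
    · refine Continuous.log (by fun_prop) fun θ => by positivity
    have hfin : (p.roots.toFinset : Set ℂ).Countable := Finset.countable_toSet _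
    filter_upwards [(hfin.preimage_circleMap 0 one_ne_zero).ae_notMem volume] with t ht
    have ht' : p.eval (circleMap 0 1 t) ≠ 0 := fun h0 => ht (by simpa [hp] using h0)
    exact Real.log_le_log (norm_pos_iff.mpr ht') (by linarith)
  linarith

/-- The one-parameter subgroup of the torus in the direction of an integer vector. -/
noncomputable def torusLine {d : Type*} (w : d → ℤ) (θ : ℝ) : UnitAddTorus d :=
  fun i => ((w i * (θ / (2 * Real.pi)) : ℝ) : UnitAddCircle)

lemma continuous_torusLine {d : Type*} (w : d → ℤ) : Continuous (torusLine w) :=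
  continuous_pi fun i => (AddCircle.continuous_mk' (1 : ℝ)).comp (by fun_prop)

namespace UnitAddTorus

variable {d : Type*} [Fintype d]

lemma mFourier_apply_add (k : d → ℤ) (x y : UnitAddTorus d) :
    mFourier k (x + y) = mFourier k x * mFourier k y := by
  simp only [mFourier, ContinuousMap.coe_mk, Pi.add_apply, fourier_apply, smul_add,
    AddCircle.toCircle_add, Circle.coe_mul, Finset.prod_mul_distrib]

lemma norm_mFourier_apply (k : d → ℤ) (x : UnitAddTorus d) : ‖mFourier k x‖ = 1 := by
  simp only [mFourier, ContinuousMap.coe_mk, fourier_apply, norm_prod, Circle.norm_coe,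
    Finset.prod_const_one]

lemma mFourier_torusLine (k w : d → ℤ) (θ : ℝ) :
    mFourier k (torusLine w θ) = circleMap 0 1 θ ^ (∑ i, k i * w i) := by
  simp only [mFourier, ContinuousMap.coe_mk, torusLine, fourier_coe_apply, circleMap, zero_add,
    Complex.ofReal_one, one_mul]
  rw [← Complex.exp_sum, ← Complex.exp_int_mul]
  congr 1
  push_cast
  rw [Finset.sum_mul]
  refine Finset.sum_congr rfl fun i _ => ?_
  field_simp [Real.pi_ne_zero]

end UnitAddTorus

/-- Kronecker substitution: $w=(1,L,L^2,\dots)$, where $L$ is a root of none of the finitely many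
polynomials with coefficients $k-l$. -/
lemma exists_intVector_injOn {d : ℕ} (N : Finset (Fin d → ℤ)) :
    ∃ w : Fin d → ℤ, Set.InjOn (fun k : Fin d → ℤ => ∑ i, k i * w i) N := by
  classical
  let Q : (Fin d → ℤ) × (Fin d → ℤ) → Polynomial ℤ := fun q =>
    ∑ i, Polynomial.C (q.1 i - q.2 i) * Polynomial.X ^ (i : ℕ)
  have hQ (q) (hq : q ∈ N.offDiag) : Q q ≠ 0 := by
    intro h0
    refine (Finset.mem_offDiag.mp hq).2.2 (funext fun i => ?_)
    have := congrArg (fun r => r.coeff (i : ℕ)) h0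
    simp only [Q, Polynomial.finsetSum_coeff, Polynomial.coeff_C_mul_X_pow,
      Polynomial.coeff_zero] at this
    rw [Finset.sum_eq_single i (fun b _ hb => if_neg fun h => hb (Fin.ext h.symm))
      (by simp), if_pos rfl] at this
    exact sub_eq_zero.mp this
  have hprod : ∏ q ∈ N.offDiag, Q q ≠ 0 := Finset.prod_ne_zero_iff.mpr hQ
  obtain ⟨L, hL⟩ := Polynomial.exists_eval_ne_zero_of_natDegree_lt_card _ hprod (by simp)
  refine ⟨fun i => L ^ (i : ℕ), fun k hk l hl hkl => ?_⟩
  by_contra hne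
  rw [Polynomial.eval_prod, Finset.prod_ne_zero_iff] at hL
  apply hL (k, l) (Finset.mem_offDiag.mpr ⟨hk, hl, hne⟩)
  simp only [Q, Polynomial.eval_finsetSum, Polynomial.eval_mul, Polynomial.eval_C,
    Polynomial.eval_pow, Polynomial.eval_X, sub_mul, Finset.sum_sub_distrib]
  exact sub_eq_zero.mpr hkl


namespace UnitAddTorus

variable {d : ℕ}

/-- The trigonometric polynomial with frequencies in `N` and coefficients `c`. -/
noncomputable def trigPoly (N : Finset (Fin d → ℤ)) (c : (Fin d → ℤ) → ℂ) :
    C(UnitAddTorus (Fin d), ℂ) :=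
  ∑ k ∈ N, c k • mFourier k

lemma trigPoly_apply (N : Finset (Fin d → ℤ)) (c : (Fin d → ℤ) → ℂ) (x : UnitAddTorus (Fin d)) :
    trigPoly N c x = ∑ k ∈ N, c k * mFourier k x := by
  simp [trigPoly, ContinuousMap.sum_apply]

lemma norm_trigPoly_le {N : Finset (Fin d → ℤ)} {c : (Fin d → ℤ) → ℂ} {B : ℝ}
    (hB : ∀ k ∈ N, ‖c k‖ ≤ B) (x : UnitAddTorus (Fin d)) : ‖trigPoly N c x‖ ≤ N.card * B := by
  rw [trigPoly_apply, ← nsmul_eq_mul]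
  refine norm_sum_le_of_le _ (fun k hk => ?_) |>.trans (Finset.sum_le_card_nsmul _ _ B hB)
  rw [norm_mul, norm_mFourier_apply, mul_one]

/-- Along a coset of the line the frequencies stay distinct. The restriction is thus a Laurent
polynomial in $e^{i\theta}$ with coefficients of the same moduli, and a power of $e^{i\theta}$ makes
it a polynomial. -/
lemma log_norm_coeff_le_average_torusLine {N : Finset (Fin d → ℤ)} {c : (Fin d → ℤ) → ℂ}
    {w : Fin d → ℤ} (hw : Set.InjOn (fun k : Fin d → ℤ => ∑ i, k i * w i) N)
    {k₀ : Fin d → ℤ} (hk₀ : k₀ ∈ N) (hc : c k₀ ≠ 0) {ε : ℝ} (hε : 0 < ε)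
    (u : UnitAddTorus (Fin d)) :
    Real.log ‖c k₀‖ - N.card * Real.log 2 ≤
      (2 * Real.pi)⁻¹ * ∫ θ in (0 : ℝ)..2 * Real.pi,
        Real.log (‖trigPoly N c (u + torusLine w θ)‖ + ε) := by
  classical
  set e : (Fin d → ℤ) → ℤ := fun k => ∑ i, k i * w i with he
  obtain ⟨m, hm⟩ : ∃ m : ℕ, ∀ k ∈ N, 0 ≤ e k + m := by
    refine ⟨∑ k ∈ N, (e k).natAbs, fun k hk => ?_⟩
    have h1 : (e k).natAbs ≤ ∑ k ∈ N, (e k).natAbs :=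
      Finset.single_le_sum (f := fun k => (e k).natAbs) (fun _ _ => Nat.zero_le _) hk
    omega
  set g : (Fin d → ℤ) → ℕ := fun k => (e k + m).toNat with hg
  have hginj : Set.InjOn g N := by
    intro k hk l hl hkl
    apply hw hk hl
    have h1 := hm k hk
    have h2 := hm l hl
    change e k = e l
    simp only [hg] at hkl
    omega
  set p : Polynomial ℂ := ∑ k ∈ N, Polynomial.monomial (g k) (c k * mFourier k u) with hp
  have hcoeff : p.coeff (g k₀) = c k₀ * mFourier k₀ u := by
    simp only [hp, Polynomial.finsetSum_coeff, Polynomial.coeff_monomial]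
    rw [Finset.sum_eq_single k₀ (fun b hb hne => if_neg fun h => hne (hginj hb hk₀ h))
      (fun h => absurd hk₀ h), if_pos rfl]
  have hnorm : ‖p.coeff (g k₀)‖ = ‖c k₀‖ := by
    rw [hcoeff, norm_mul, norm_mFourier_apply, mul_one]
  have hcard : p.support.card ≤ N.card := by
    calc p.support.card ≤ (N.image g).card := by
          refine Finset.card_le_card fun j hj => ?_
          rw [Polynomial.mem_support_iff, hp, Polynomial.finsetSum_coeff] at hj
          obtain ⟨k, hk, hne⟩ := Finset.exists_ne_zero_of_sum_ne_zero hj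
          rw [Polynomial.coeff_monomial] at hne
          exact Finset.mem_image.mpr ⟨k, hk, of_not_not fun h => hne (if_neg h)⟩
      _ ≤ N.card := Finset.card_image_le
  have heval (θ : ℝ) : ‖p.eval (circleMap 0 1 θ)‖ = ‖trigPoly N c (u + torusLine w θ)‖ := by
    have hz : circleMap 0 1 θ ≠ 0 := circleMap_ne_center one_ne_zero
    have : p.eval (circleMap 0 1 θ) =
        circleMap 0 1 θ ^ m * trigPoly N c (u + torusLine w θ) := by
      rw [hp, Polynomial.eval_finsetSum, trigPoly_apply, Finset.mul_sum]
      refine Finset.sum_congr rfl fun k hk => ?_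
      rw [Polynomial.eval_monomial, mFourier_apply_add, mFourier_torusLine, ← zpow_natCast,
        ← zpow_natCast, hg, Int.toNat_of_nonneg (hm k hk), zpow_add₀ hz]
      ring
    rw [this, norm_mul, norm_pow]
    simp
  have := log_norm_coeff_le_average_log hcard (j := g k₀)
    (by rw [← norm_ne_zero_iff, hnorm]; exact norm_ne_zero_iff.mpr hc) hε
  simpa only [hnorm, heval] using this

/-- A coefficient of a trigonometric polynomial on the torus is controlled by the mean of the
logarithm of its modulus and the number of frequencies. -/
lemma log_norm_coeff_le_integral_log {N : Finset (Fin d → ℤ)} {c : (Fin d → ℤ) → ℂ}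
    {k₀ : Fin d → ℤ} (hk₀ : k₀ ∈ N) (hc : c k₀ ≠ 0) {ε : ℝ} (hε : 0 < ε) :
    Real.log ‖c k₀‖ - N.card * Real.log 2 ≤
      ∫ u : UnitAddTorus (Fin d), Real.log (‖trigPoly N c u‖ + ε) := by
  obtain ⟨w, hw⟩ := exists_intVector_injOn N
  set Φ : UnitAddTorus (Fin d) → ℝ := fun u => Real.log (‖trigPoly N c u‖ + ε) with hΦ
  have hΦc : Continuous Φ := Continuous.log (by fun_prop) fun u => by positivity
  obtain ⟨B, hB⟩ : ∃ B, ∀ u, ‖Φ u‖ ≤ B := by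
    obtain ⟨B, hB⟩ := isCompact_univ.exists_bound_of_continuousOn hΦc.continuousOn
    exact ⟨B, fun u => hB u trivial⟩
  have hcont : Continuous (Function.uncurry fun (θ : ℝ) (u : UnitAddTorus (Fin d)) =>
      Φ (u + torusLine w θ)) :=
    hΦc.comp (continuous_snd.add ((continuous_torusLine w).comp continuous_fst))
  have hint : Integrable (Function.uncurry fun (θ : ℝ) (u : UnitAddTorus (Fin d)) =>
      Φ (u + torusLine w θ))
      ((volume.restrict (Set.uIoc 0 (2 * Real.pi))).prod volume) := by
    rw [Set.uIoc_of_le Real.two_pi_pos.le]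
    exact Integrable.of_bound hcont.aestronglyMeasurable B (Filter.Eventually.of_forall fun q => hB _)
  -- Averaging over the base point `u` turns line averages into the torus average, by translation
  -- invariance.
  have hswap := intervalIntegral_integral_swap hint
  have hinv (θ : ℝ) : ∫ u, Φ (u + torusLine w θ) = ∫ u, Φ u := integral_add_right_eq_self Φ _
  simp only [hinv, intervalIntegral.integral_const, sub_zero, smul_eq_mul] at hswap
  have hpt := fun u => log_norm_coeff_le_average_torusLine hw hk₀ hc hε u
  have hmono := integral_mono (μ := (volume : Measure (UnitAddTorus (Fin d))))
    (integrable_const _) (?_) hpt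
  · rw [integral_const_mul, ← hswap, integral_const, probReal_univ, one_smul,
      inv_mul_cancel_left₀ (by positivity)] at hmono
    exact hmono
  · have h2 := hint.integral_prod_right
    refine Integrable.const_mul (h2.congr (Filter.Eventually.of_forall fun u => ?_)) _
    simp only [Function.uncurry]
    rw [intervalIntegral.integral_of_le Real.two_pi_pos.le, Set.uIoc_of_le Real.two_pi_pos.le]

/-- Since $nc+\varepsilon\le 2^nc$, the hypothesis gives $\eta\log(c/a)\le 2n\log 2+1/2$. Dividing
by $\eta\ge 1/2$ and doubling gives $c^2\le e^2\,2^{8n}a^2$, and $e^2\le 8$. -/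
lemma sq_le_of_forall_log_le {n : ℕ} {c a ε η : ℝ} (hc : 0 < c) (ha : 0 < a) (hε : 0 < ε)
    (hεc : ε ≤ c) (hη : 1 / 2 ≤ η) (hη1 : η ≤ 1)
    (h : Real.log c - n * Real.log 2 ≤
      η * Real.log a + 1 / 2 + (1 - η) * Real.log (n * c + ε)) :
    c ^ 2 ≤ 8 * 256 ^ n * a ^ 2 := by
  have h2 := Real.log_pos one_lt_two
  have h3 : Real.log (n * c + ε) ≤ n * Real.log 2 + Real.log c := by
    rw [← Real.log_pow, ← Real.log_mul (by positivity) hc.ne']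
    refine Real.log_le_log (by positivity) ?_
    have : (n : ℝ) + 1 ≤ 2 ^ n := by exact_mod_cast Nat.lt_two_pow_self
    nlinarith
  have h4 : η * (Real.log c - Real.log a) ≤ 2 * (n * Real.log 2) + 1 / 2 := by
    have h5 := mul_le_mul_of_nonneg_left h3 (sub_nonneg.mpr hη1)
    have h6 : 0 ≤ η * (n * Real.log 2) := by positivity
    nlinarith
  have h7 : Real.log c - Real.log a ≤ 4 * (n * Real.log 2) + 1 := by
    rcases le_total (Real.log c - Real.log a) 0 with h0 | h0
    · have : 0 ≤ n * Real.log 2 := by positivity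
      linarith
    · nlinarith
  have h8 : 2 * Real.log c ≤ Real.log (256 ^ n * a ^ 2) + 2 := by
    rw [Real.log_mul (by positivity) (by positivity), Real.log_pow, Real.log_pow,
      show (256 : ℝ) = 2 ^ 8 by norm_num, Real.log_pow]
    push_cast
    linarith
  calc c ^ 2 = Real.exp (2 * Real.log c) := by
        rw [mul_comm, Real.exp_mul, Real.exp_log hc]; norm_cast
    _ ≤ Real.exp (Real.log (256 ^ n * a ^ 2) + 2) := Real.exp_le_exp.mpr h8
    _ = Real.exp 1 ^ 2 * (256 ^ n * a ^ 2) := by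
        rw [Real.exp_add, Real.exp_log (by positivity), Real.exp_one_pow, mul_comm, Nat.cast_ofNat]
    _ ≤ 8 * (256 ^ n * a ^ 2) := by
        gcongr
        have := Real.exp_one_lt_d9
        have := Real.exp_pos 1
        nlinarith
    _ = _ := by ring

/-- **Turán-Nazarov inequality** on the torus: the coefficients of a trigonometric polynomial are
controlled by its `L²` norm on a set of measure at least one half. -/
theorem sq_norm_coeff_le_setIntegral {N : Finset (Fin d → ℤ)} (c : (Fin d → ℤ) → ℂ)
    {E : Set (UnitAddTorus (Fin d))} (hE : MeasurableSet E) (hE2 : 1 / 2 ≤ volume.real E)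
    {k₀ : Fin d → ℤ} (hk₀ : k₀ ∈ N) :
    ‖c k₀‖ ^ 2 ≤ 16 * 256 ^ N.card * ∫ u in E, ‖trigPoly N c u‖ ^ 2 := by
  -- For the largest coefficient, $|P|\le|N||c_{k_1}|$ controls the logarithm off `E`.
  obtain ⟨k₁, hk₁, hmax⟩ := Finset.exists_max_image N (fun k => ‖c k‖) ⟨k₀, hk₀⟩
  refine (pow_le_pow_left₀ (norm_nonneg _) (hmax k₀ hk₀) 2).trans ?_
  have hI0 : 0 ≤ ∫ u in E, ‖trigPoly N c u‖ ^ 2 := integral_nonneg fun u => by positivity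
  rcases (norm_nonneg (c k₁)).eq_or_lt with h0 | hpos
  · rw [← h0, zero_pow two_ne_zero]
    positivity
  have hfin (f : UnitAddTorus (Fin d) → ℝ) (hf : Continuous f) : Integrable f := by
    obtain ⟨B, hB⟩ := isCompact_univ.exists_bound_of_continuousOn hf.continuousOn
    exact Integrable.of_bound hf.aestronglyMeasurable B
      (Filter.Eventually.of_forall fun u => hB u trivial)
  have key (ε : ℝ) (hε : 0 < ε) (hεc : ε ≤ ‖c k₁‖) : ‖c k₁‖ ^ 2 ≤
      8 * 256 ^ N.card * ∫ u in E, (‖trigPoly N c u‖ + ε) ^ 2 := by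
    set A := ∫ u in E, (‖trigPoly N c u‖ + ε) ^ 2 with hA
    have hApos : 0 < A := by
      have h1 : ∫ u in E, ε ^ 2 ≤ A :=
        integral_mono (integrable_const _) (hfin _ (by fun_prop)).integrableOn fun u => by
          have := norm_nonneg (trigPoly N c u)
          show ε ^ 2 ≤ _
          gcongr
          linarith
      rw [setIntegral_const, smul_eq_mul] at h1
      have : 0 < volume.real E := by linarith
      exact lt_of_lt_of_le (by positivity) h1
    have hlogi : Integrable fun u => Real.log (‖trigPoly N c u‖ + ε) :=
      hfin _ (Continuous.log (by fun_prop) fun u => by positivity)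
    have h1 := log_norm_coeff_le_integral_log hk₁ (norm_pos_iff.mp hpos) hε
    rw [← integral_add_compl hE hlogi] at h1
    -- Jensen's inequality on `E`, in the form $\log t\le t-1$ with $t=(|P|+\varepsilon)^2/A$.
    have h2 : ∫ u in E, Real.log (‖trigPoly N c u‖ + ε) ≤
        volume.real E * Real.log (√A) + 1 / 2 := by
      calc _ ≤ ∫ u in E, (Real.log (√A) - 1 / 2 + (2 * A)⁻¹ * (‖trigPoly N c u‖ + ε) ^ 2) := by
            refine integral_mono hlogi.integrableOn
              (hfin _ (by fun_prop)).integrableOn fun u => ?_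
            have hp : 0 < ‖trigPoly N c u‖ + ε := by positivity
            have h3 := Real.log_le_sub_one_of_pos
              (show 0 < (‖trigPoly N c u‖ + ε) ^ 2 / A by positivity)
            rw [Real.log_div (by positivity) hApos.ne', Real.log_pow] at h3
            rw [Real.log_sqrt hApos.le]
            have h4 : (2 * A)⁻¹ * (‖trigPoly N c u‖ + ε) ^ 2 =
              ((‖trigPoly N c u‖ + ε) ^ 2 / A) / 2 := by field_simp
            simp only [h4]
            push_cast at h3
            linarith
        _ = volume.real E * (Real.log (√A) - 1 / 2) + 1 / 2 := by
            rw [integral_add (integrable_const _)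
              ((hfin _ (by fun_prop)).integrableOn.const_mul _), setIntegral_const,
              integral_const_mul, ← hA, smul_eq_mul]
            field_simp
        _ ≤ _ := by nlinarith
    have h3 : ∫ u in Eᶜ, Real.log (‖trigPoly N c u‖ + ε) ≤
        (1 - volume.real E) * Real.log (N.card * ‖c k₁‖ + ε) := by
      rw [← probReal_compl_eq_one_sub hE, ← smul_eq_mul, ← setIntegral_const]
      refine integral_mono hlogi.integrableOn (integrable_const _) fun u => ?_
      exact Real.log_le_log (by positivity) (by gcongr; exact norm_trigPoly_le hmax u)
    have h4 := sq_le_of_forall_log_le (n := N.card) hpos (Real.sqrt_pos.mpr hApos) hε hεc hE2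
      measureReal_le_one (by linarith)
    rwa [Real.sq_sqrt hApos.le] at h4
  refine le_of_forall_pos_le_add fun δ hδ => ?_
  set K : ℝ := 16 * 256 ^ N.card with hK
  have hKpos : 0 < K := by positivity
  -- Removing `ε` by $(|P|+\varepsilon)^2\le 2|P|^2+2\varepsilon^2$ doubles the constant 8 and
  -- leaves an error of at most $K\varepsilon^2\le\delta$.
  set ε := min ‖c k₁‖ (√(δ / K)) with hε
  have hεpos : 0 < ε := lt_min hpos (Real.sqrt_pos.mpr (by positivity))
  have hε2 : K * ε ^ 2 ≤ δ := by
    have : ε ^ 2 ≤ δ / K := by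
      rw [← Real.sq_sqrt (show 0 ≤ δ / K by positivity)]
      exact pow_le_pow_left₀ hεpos.le (min_le_right _ _) 2
    rw [le_div_iff₀ hKpos] at this
    linarith
  have h1 : ∫ u in E, (‖trigPoly N c u‖ + ε) ^ 2 ≤
      ∫ u in E, (2 * ‖trigPoly N c u‖ ^ 2 + 2 * ε ^ 2) := by
    refine integral_mono (hfin _ (by fun_prop)).integrableOn
      (hfin _ (by fun_prop)).integrableOn fun u => ?_
    simp only
    nlinarith [sq_nonneg (‖trigPoly N c u‖ - ε)]
  rw [integral_add (hfin _ (by fun_prop)).integrableOn (integrable_const _), integral_const_mul,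
    setIntegral_const, smul_eq_mul] at h1
  have h2 : volume.real E ≤ 1 := measureReal_le_one
  calc ‖c k₁‖ ^ 2 ≤ K / 2 * ∫ u in E, (‖trigPoly N c u‖ + ε) ^ 2 := by
        have := key ε hεpos (min_le_left _ _)
        rw [hK]
        linarith
    _ ≤ K / 2 * (2 * (∫ u in E, ‖trigPoly N c u‖ ^ 2) + 2 * ε ^ 2) := by
        gcongr
        nlinarith [sq_nonneg ε]
    _ ≤ _ := by linarith

end UnitAddTorus

/-! ### Pushing an integrable function forward to the torus -/

lemma exists_clm_integral_mul_comp {X T : Type*} [MeasurableSpace X] {μ : Measure X}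
    [TopologicalSpace T] [CompactSpace T] [MeasurableSpace T] [BorelSpace T] {F : X → ℂ}
    (hF : Integrable F μ) {π : X → T} (hπ : Measurable π) :
    ∃ L : C(T, ℂ) →L[ℂ] ℂ, ∀ g, L g = ∫ x, F x * g (π x) ∂μ := by
  have hint (g : C(T, ℂ)) : Integrable (fun x => F x * g (π x)) μ :=
    hF.mul_bdd (c := ‖g‖) (g.measurable.comp hπ).aestronglyMeasurable
      (Filter.Eventually.of_forall fun x => g.norm_coe_le_norm _)
  refine ⟨LinearMap.mkContinuous
    { toFun := fun g => ∫ x, F x * g (π x) ∂μ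
      map_add' := fun g h => ?_
      map_smul' := fun c g => ?_ } (∫ x, ‖F x‖ ∂μ) fun g => ?_, fun g => rfl⟩
  · simp only [ContinuousMap.add_apply, mul_add]
    exact integral_add (hint g) (hint h)
  · simp only [ContinuousMap.smul_apply, smul_eq_mul, RingHom.id_apply, mul_left_comm _ c]
    exact integral_const_mul _ _
  · rw [← integral_mul_const]
    refine norm_integral_le_of_norm_le (hF.norm.mul_const _)
      (Filter.Eventually.of_forall fun x => ?_)
    rw [norm_mul]
    gcongr
    exact g.norm_coe_le_norm _

lemma tendsto_integral_mul_apprSeq {X T : Type*} [MeasurableSpace X] {μ : Measure X}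
    [TopologicalSpace T] [HasOuterApproxClosed T] [MeasurableSpace T] [BorelSpace T] {F : X → ℂ}
    (hF : Integrable F μ) {π : X → T} (hπ : Measurable π) {E : Set T} (hE : IsClosed E) :
    Filter.Tendsto (fun n => ∫ x, F x * ((hE.apprSeq n (π x) : ℝ) : ℂ) ∂μ) Filter.atTop
      (nhds (∫ x in π ⁻¹' E, F x ∂μ)) := by
  rw [← integral_indicator (hπ hE.measurableSet)]
  refine tendsto_integral_of_dominated_convergence (fun x => ‖F x‖) (fun n => ?_) hF.norm
    (fun n => Filter.Eventually.of_forall fun x => ?_) (Filter.Eventually.of_forall fun x => ?_)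
  · refine hF.1.mul (Measurable.aestronglyMeasurable ?_)
    have := (hE.apprSeq n).continuous.measurable.comp hπ
    fun_prop
  · rw [norm_mul, Complex.norm_real, Real.norm_of_nonneg (NNReal.coe_nonneg _)]
    refine mul_le_of_le_one_right (norm_nonneg _) ?_
    exact_mod_cast HasOuterApproxClosed.apprSeq_apply_le_one hE n (π x)
  · have h1 := tendsto_pi_nhds.mp (HasOuterApproxClosed.tendsto_apprSeq hE) (π x)
    have h2 : Filter.Tendsto (fun n => F x * ((hE.apprSeq n (π x) : ℝ) : ℂ)) Filter.atTop
        (nhds (F x * (((E.indicator (fun _ => 1) (π x) : NNReal) : ℝ) : ℂ))) :=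
      (((Complex.continuous_ofReal.comp NNReal.continuous_coe).tendsto _).comp h1).const_mul _
    convert h2 using 2
    by_cases h : π x ∈ E <;> simp [h]

namespace UnitAddTorus

variable {d : ℕ}

/-- Both sides are bounded functionals of `g` that agree on characters, whose span is dense. Thus
`H` is the density of the pushforward of $F\,d\mu$. -/
lemma integral_mul_eq_integral_comp {X : Type*} [MeasurableSpace X] {μ : Measure X} {F : X → ℂ}
    (hF : Integrable F μ) {π : X → UnitAddTorus (Fin d)} (hπ : Measurable π)
    (H : Lp ℂ 2 (volume : Measure (UnitAddTorus (Fin d))))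
    (hH : ∀ k, mFourierCoeff H k = ∫ x, F x * mFourier (-k) (π x) ∂μ)
    (g : C(UnitAddTorus (Fin d), ℂ)) :
    ∫ t, H t * g t = ∫ x, F x * g (π x) ∂μ := by
  have hHi : Integrable H volume := (Lp.memLp H).integrable one_le_two
  obtain ⟨L₁, hL₁⟩ := exists_clm_integral_mul_comp hHi (π := id) measurable_id
  obtain ⟨L₂, hL₂⟩ := exists_clm_integral_mul_comp hF hπ
  suffices L₁ = L₂ by rw [← hL₂, ← this, hL₁]; rfl
  refine ContinuousLinearMap.ext_on (s := Set.range (mFourier (d := Fin d))) ?_ ?_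
  · have := span_mFourier_closure_eq_top (d := Fin d)
    rwa [← Submodule.dense_iff_topologicalClosure_eq_top] at this
  · rintro _ ⟨k, rfl⟩
    have := hH (-k)
    rw [neg_neg] at this
    rw [hL₁, hL₂, ← this, mFourierCoeff, neg_neg]
    simp only [id, smul_eq_mul, mul_comm]

/-- Closedness of `E` makes its indicator a bounded limit of continuous functions, against which `H`
and $F$ integrate alike. So $1_EH$ has zero Fourier coefficients, and Parseval applies. -/
lemma setIntegral_sq_norm_eq_zero {X : Type*} [MeasurableSpace X] {μ : Measure X} {F : X → ℂ}
    (hF : Integrable F μ) {π : X → UnitAddTorus (Fin d)} (hπ : Measurable π)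
    (H : Lp ℂ 2 (volume : Measure (UnitAddTorus (Fin d))))
    (hH : ∀ k, mFourierCoeff H k = ∫ x, F x * mFourier (-k) (π x) ∂μ)
    {E : Set (UnitAddTorus (Fin d))} (hE : IsClosed E) (hFE : ∀ᵐ x ∂μ, π x ∈ E → F x = 0) :
    ∫ t in E, ‖H t‖ ^ 2 = 0 := by
  have hHi : Integrable H volume := (Lp.memLp H).integrable one_le_two
  have hzero (k : Fin d → ℤ) : ∫ t in E, H t * mFourier k t = 0 := by
    have hb (g : C(UnitAddTorus (Fin d), ℂ)) : Integrable (fun x => F x * g (π x)) μ :=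
      hF.mul_bdd (c := ‖g‖) (g.measurable.comp hπ).aestronglyMeasurable
        (Filter.Eventually.of_forall fun x => g.norm_coe_le_norm _)
    have hb' (g : C(UnitAddTorus (Fin d), ℂ)) : Integrable (fun x => H x * g x) volume :=
      hHi.mul_bdd (c := ‖g‖) g.measurable.aestronglyMeasurable
        (Filter.Eventually.of_forall fun x => g.norm_coe_le_norm _)
    have h1 := tendsto_integral_mul_apprSeq (hb' (mFourier k)) (π := id) measurable_id hE
    have h2 := tendsto_integral_mul_apprSeq (hb (mFourier k)) hπ hE
    have h3 : ∫ x in π ⁻¹' E, F x * mFourier k (π x) ∂μ = 0 := by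
      refine setIntegral_eq_zero_of_ae_eq_zero ?_
      filter_upwards [hFE] with x hx hxE
      rw [hx hxE, zero_mul]
    rw [h3] at h2
    refine tendsto_nhds_unique h1 (h2.congr fun n => ?_)
    let ψ : C(UnitAddTorus (Fin d), ℂ) := ⟨fun t => ((hE.apprSeq n t : ℝ) : ℂ), by
      have := (hE.apprSeq n).continuous
      fun_prop⟩
    have h4 := integral_mul_eq_integral_comp hF hπ H hH (mFourier k * ψ)
    simp only [ContinuousMap.mul_apply, ← mul_assoc] at h4
    exact h4.symm
  have hG : MemLp (E.indicator H) 2 volume := (Lp.memLp H).indicator hE.measurableSet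
  have hs := hasSum_sq_mFourierCoeff hG.toLp
  have hc (k : Fin d → ℤ) : mFourierCoeff hG.toLp k = 0 := by
    rw [mFourierCoeff, ← hzero (-k), ← integral_indicator hE.measurableSet]
    refine integral_congr_ae ?_
    filter_upwards [hG.coeFn_toLp] with t ht
    rw [ht, smul_eq_mul]
    by_cases h : t ∈ E <;> simp [h, mul_comm]
  simp only [hc, norm_zero, ne_eq, OfNat.ofNat_ne_zero, not_false_eq_true, zero_pow] at hs
  rw [← integral_indicator hE.measurableSet, ← hs.unique hasSum_zero]
  refine integral_congr_ae ?_
  filter_upwards [hG.coeFn_toLp] with t ht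
  rw [ht]
  by_cases h : t ∈ E <;> simp [h]

/-- If the right side is finite, all of `a` is square summable, so the pushforward has an $L^2$
density `H`, which vanishes on `E`. There the polynomial with frequencies in `N` equals minus the
remainder `R`; Turán–Nazarov for it and Parseval for `R` conclude. -/
theorem sq_enorm_coeff_zero_le_tsum {X : Type*} [MeasurableSpace X] {μ : Measure X} {F : X → ℂ}
    (hF : Integrable F μ) {π : X → UnitAddTorus (Fin d)} (hπ : Measurable π)
    {E : Set (UnitAddTorus (Fin d))} (hE : IsClosed E) (hE2 : 1 / 2 ≤ volume.real E)
    (hFE : ∀ᵐ x ∂μ, π x ∈ E → F x = 0)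
    {a : (Fin d → ℤ) → ℂ} (ha : ∀ k, a k = ∫ x, F x * mFourier (-k) (π x) ∂μ)
    {N : Finset (Fin d → ℤ)} {k₀ : Fin d → ℤ} (hk₀ : k₀ ∈ N) :
    ‖a k₀‖ₑ ^ 2 ≤ 16 * 256 ^ N.card * ∑' k, if k ∈ N then 0 else ‖a k‖ₑ ^ 2 := by
  classical
  by_cases htop : ∑' k, (if k ∈ N then 0 else ‖a k‖ₑ ^ 2) = ∞
  · rw [htop, ENNReal.mul_top (by positivity)]
    exact le_top
  have hterm (k : Fin d → ℤ) : (if k ∈ N then 0 else ‖a k‖ₑ ^ 2) =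
      ENNReal.ofReal (if k ∈ N then 0 else ‖a k‖ ^ 2) := by
    split_ifs
    · simp
    · rw [ENNReal.ofReal_pow (norm_nonneg _), ofReal_norm]
  have hsumN : Summable fun k => if k ∈ N then 0 else ‖a k‖ ^ 2 := by
    simp only [hterm] at htop
    have := ENNReal.summable_toReal htop
    refine this.congr fun k => ENNReal.toReal_ofReal ?_
    split_ifs <;> positivity
  have hsum : Summable fun k => ‖a k‖ ^ 2 := by
    refine (hsumN.congr_cofinite ?_)
    filter_upwards [N.finite_toSet.compl_mem_cofinite] with k hk
    exact if_neg hk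
  let A : lp (fun _ : Fin d → ℤ => ℂ) 2 := ⟨a, by
    refine (memℓp_gen_iff (p := 2) (by simp)).mpr ?_
    simpa using hsum⟩
  set H := mFourierBasis.repr.symm A with hHdef
  have hH (k : Fin d → ℤ) : mFourierCoeff H k = a k := by
    rw [← mFourierBasis_repr, hHdef, LinearIsometryEquiv.apply_symm_apply]
  have hzero := setIntegral_sq_norm_eq_zero hF hπ H (fun k => (hH k).trans (ha k)) hE hFE
  set R := H - (trigPoly N a).toLp 2 volume ℂ with hR
  have hRc (k : Fin d → ℤ) : mFourierCoeff R k = if k ∈ N then 0 else a k := by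
    rw [← mFourierBasis_repr, hR, map_sub, trigPoly, map_sum, map_sum]
    simp only [map_smul, lp.coeFn_sub, Pi.sub_apply]
    rw [mFourierBasis_repr, hH]
    have (i : Fin d → ℤ) : ContinuousMap.toLp 2 volume ℂ (mFourier i) = mFourierBasis i := by
      rw [coe_mFourierBasis]
    simp only [this, HilbertBasis.repr_self, lp.coeFn_sum, lp.coeFn_smul, Finset.sum_apply,
      Pi.smul_apply, lp.single_apply, smul_eq_mul, Pi.single_apply]
    simp only [mul_ite, mul_one, mul_zero, Finset.sum_ite_eq]
    split_ifs <;> simp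
  have hP := hasSum_sq_mFourierCoeff R
  have hRP : ∫ u in E, ‖trigPoly N a u‖ ^ 2 = ∫ u in E, ‖R u‖ ^ 2 := by
    have hH0 : ∀ᵐ u ∂(volume.restrict E), ‖H u‖ ^ 2 = 0 :=
      (integral_eq_zero_iff_of_nonneg (fun u => by positivity)
        ((Lp.memLp H).integrable_norm_pow two_ne_zero).integrableOn).mp hzero
    refine integral_congr_ae ?_
    filter_upwards [hH0, ae_restrict_of_ae (Lp.coeFn_sub H ((trigPoly N a).toLp 2 volume ℂ)),
      ae_restrict_of_ae (ContinuousMap.coeFn_toLp (𝕜 := ℂ) (p := 2) volume (trigPoly N a))]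
      with u h1 h2 h3
    have h4 : H u = 0 := by simpa using h1
    rw [hR, h2, Pi.sub_apply, h3, h4, zero_sub, norm_neg]
  have hmain := sq_norm_coeff_le_setIntegral a hE.measurableSet hE2 hk₀
  have hle : ∫ u in E, ‖R u‖ ^ 2 ≤ ∫ u, ‖R u‖ ^ 2 :=
    setIntegral_le_integral ((Lp.memLp R).integrable_norm_pow two_ne_zero)
      (Filter.Eventually.of_forall fun u => by positivity)
  have hP' : ∑' k, (if k ∈ N then 0 else ‖a k‖ ^ 2) = ∫ u, ‖R u‖ ^ 2 := by
    rw [← hP.tsum_eq]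
    refine tsum_congr fun k => ?_
    rw [hRc]
    split_ifs <;> simp
  simp only [hterm]
  rw [← ENNReal.ofReal_tsum_of_nonneg (fun k => by split_ifs <;> positivity) hsumN, hP',
    ← ofReal_norm, ← ENNReal.ofReal_pow (norm_nonneg _)]
  have hK : (16 * 256 ^ N.card : ℝ≥0∞) = ENNReal.ofReal (16 * 256 ^ N.card) := by
    rw [ENNReal.ofReal_mul (by norm_num), ENNReal.ofReal_pow (by norm_num)]
    norm_num
  rw [hK, ← ENNReal.ofReal_mul (by positivity)]
  refine ENNReal.ofReal_le_ofReal (hmain.trans ?_)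
  rw [hRP]
  gcongr

end UnitAddTorus

/-! ### Random lattices and a mean value inequality -/

lemma lintegral_pi_le_of_forall_update {ι α : Type*} [Fintype ι] [DecidableEq ι]
    [MeasurableSpace α] {μ : Measure α} [IsProbabilityMeasure μ] {f : (ι → α) → ℝ≥0∞}
    (hf : Measurable f) (i : ι) {K : ℝ≥0∞}
    (h : ∀ x, ∫⁻ v, f (Function.update x i v) ∂μ ≤ K) :
    ∫⁻ x, f x ∂(Measure.pi fun _ => μ) ≤ K := by
  calc _ ≤ ∫⁻ _, K ∂(Measure.pi fun _ : ι => μ) := by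
        refine lintegral_le_of_lmarginal_le {i} hf measurable_const ?_
        simp only [lmarginal_singleton]
        intro x
        simpa using h x
    _ = K := by simp

lemma lintegral_add_smul {E : Type*} [NormedAddCommGroup E] [NormedSpace ℝ E]
    [FiniteDimensional ℝ E] [MeasurableSpace E] [BorelSpace E] (μ : Measure E) [μ.IsAddHaarMeasure]
    {g : E → ℝ≥0∞} (hg : Measurable g) (c : E) {r : ℝ} (hr : r ≠ 0) :
    ∫⁻ v, g (c + r • v) ∂μ = ENNReal.ofReal |(r ^ Module.finrank ℝ E)⁻¹| * ∫⁻ x, g x ∂μ := by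
  have h1 : ∫⁻ v, g (c + r • v) ∂μ = ∫⁻ y, g (c + y) ∂(μ.map (r • ·)) :=
    (lintegral_map (hg.comp (measurable_const_add c)) (measurable_const_smul r)).symm
  rw [h1, Measure.map_addHaar_smul μ hr, lintegral_smul_measure, smul_eq_mul,
    lintegral_add_left_eq_self g c]

section RandomLattice

variable {d : ℕ}

/-- The basis `lam (e_i + b_i / (2d))`, a perturbation of a multiple of the standard basis. -/
noncomputable def perturbedBasis (lam : ℝ) (b : Fin d → EuclideanSpace ℝ (Fin d)) (i : Fin d) :
    EuclideanSpace ℝ (Fin d) :=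
  lam • (EuclideanSpace.single i 1 + (2 * d : ℝ)⁻¹ • b i)

/-- The point with integer coordinates `k` of the lattice spanned by `perturbedBasis lam b`. -/
noncomputable def perturbedPoint (lam : ℝ) (b : Fin d → EuclideanSpace ℝ (Fin d))
    (k : Fin d → ℤ) : EuclideanSpace ℝ (Fin d) :=
  ∑ i, (k i : ℝ) • perturbedBasis lam b i

/-- An integer vector as a vector of the Euclidean space. -/
noncomputable def intVec (k : Fin d → ℤ) : EuclideanSpace ℝ (Fin d) :=
  WithLp.toLp 2 fun i => (k i : ℝ)

/-- The uniform probability measure on the closed unit ball. -/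
noncomputable def unitBallMeasure (d : ℕ) : Measure (EuclideanSpace ℝ (Fin d)) :=
  ProbabilityTheory.cond volume (Metric.closedBall 0 1)

instance : IsProbabilityMeasure (unitBallMeasure d) :=
  ProbabilityTheory.cond_isProbabilityMeasure_of_finite
    (Metric.measure_closedBall_pos volume _ one_pos).ne' measure_closedBall_lt_top.ne

@[fun_prop]
lemma measurable_perturbedPoint (lam : ℝ) (k : Fin d → ℤ) :
    Measurable fun b : Fin d → EuclideanSpace ℝ (Fin d) => perturbedPoint lam b k := by
  unfold perturbedPoint perturbedBasis
  fun_prop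

lemma perturbedPoint_eq (lam : ℝ) (b : Fin d → EuclideanSpace ℝ (Fin d)) (k : Fin d → ℤ) :
    perturbedPoint lam b k = lam • intVec k + ∑ i, (lam * k i * (2 * d : ℝ)⁻¹) • b i := by
  have h : intVec k = ∑ i, (k i : ℝ) • EuclideanSpace.single i (1 : ℝ) := by
    ext j
    simp [intVec, Finset.sum_apply, Pi.single_apply]
  rw [perturbedPoint, h, Finset.smul_sum, ← Finset.sum_add_distrib]
  refine Finset.sum_congr rfl fun i _ => ?_
  rw [perturbedBasis]
  module

lemma exists_norm_apply_eq_norm [NeZero d] (k : Fin d → ℤ) : ∃ i, ‖k i‖ = ‖k‖ := by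
  obtain ⟨i, hi⟩ := Finite.exists_max fun i => ‖k i‖
  exact ⟨i, le_antisymm (norm_le_pi_norm k i)
    ((pi_norm_le_iff_of_nonneg (norm_nonneg _)).mpr hi)⟩

/-- Each of the $d$ perturbations contributes at most $\|k\|/(2d)$, with the sup norm of $k$; this
is why the basis is perturbed by $b_i/(2d)$. -/
lemma norm_inv_smul_perturbedPoint_sub_le [NeZero d] {lam : ℝ} (hlam : 0 < lam)
    {b : Fin d → EuclideanSpace ℝ (Fin d)} (hb : ∀ i, ‖b i‖ ≤ 1) (k : Fin d → ℤ) :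
    ‖lam⁻¹ • perturbedPoint lam b k - intVec k‖ ≤ ‖k‖ / 2 := by
  have hd : (0 : ℝ) < d := by exact_mod_cast Nat.pos_of_ne_zero (NeZero.ne d)
  have h1 : lam⁻¹ • perturbedPoint lam b k - intVec k = ∑ i, (k i * (2 * d : ℝ)⁻¹) • b i := by
    rw [perturbedPoint_eq, smul_add, inv_smul_smul₀ hlam.ne', add_sub_cancel_left,
      Finset.smul_sum]
    refine Finset.sum_congr rfl fun i _ => ?_
    rw [smul_smul]
    congr 1
    field_simp
  rw [h1]
  calc _ ≤ ∑ _i : Fin d, ‖k‖ * (2 * d : ℝ)⁻¹ := by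
        refine norm_sum_le_of_le _ fun i _ => ?_
        rw [norm_smul, norm_mul, Real.norm_of_nonneg (by positivity : (0 : ℝ) ≤ (2 * d : ℝ)⁻¹)]
        have h2 : ‖(k i : ℝ)‖ ≤ ‖k‖ := by
          rw [Int.norm_cast_real]; exact norm_le_pi_norm k i
        calc _ ≤ ‖k‖ * (2 * d : ℝ)⁻¹ * 1 := by gcongr; exact hb i
          _ = _ := mul_one _
    _ = ‖k‖ / 2 := by
        rw [Finset.sum_const, Finset.card_univ, Fintype.card_fin, nsmul_eq_mul]
        field_simp

lemma ae_norm_le_one_of_unitBallMeasure :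
    ∀ᵐ b ∂(Measure.pi fun _ : Fin d => unitBallMeasure d), ∀ i, ‖b i‖ ≤ 1 := by
  rw [ae_all_iff]
  intro i
  have h : ∀ᵐ v ∂(unitBallMeasure d), ‖v‖ ≤ 1 := by
    refine Measure.ae_smul_measure ?_ _
    filter_upwards [ae_restrict_mem Metric.isClosed_closedBall.measurableSet] with v hv
    simpa using hv
  exact (Measure.quasiMeasurePreserving_eval (fun _ : Fin d => unitBallMeasure d) i).ae h

/-- Freeze every `b j` except the one at which $|k_i|=\|k\|$. The point is then affine in `b i` with
ratio $\lambda k_i/(2d)$, which bounds the density of its law. -/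
lemma lintegral_perturbedPoint_le [NeZero d] {lam : ℝ} (hlam : 0 < lam)
    {g : EuclideanSpace ℝ (Fin d) → ℝ≥0∞} (hg : Measurable g) {k : Fin d → ℤ} (hk : k ≠ 0) :
    ∫⁻ b, g (perturbedPoint lam b k) ∂(Measure.pi fun _ : Fin d => unitBallMeasure d) ≤
      (volume (Metric.closedBall (0 : EuclideanSpace ℝ (Fin d)) 1))⁻¹ *
        ENNReal.ofReal (((lam * ‖k‖ * (2 * d : ℝ)⁻¹) ^ d)⁻¹) *
          ∫⁻ x in {x | ‖lam⁻¹ • x - intVec k‖ ≤ ‖k‖ / 2}, g x := by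
  have hd : (0 : ℝ) < d := by exact_mod_cast Nat.pos_of_ne_zero (NeZero.ne d)
  set D := {x : EuclideanSpace ℝ (Fin d) | ‖lam⁻¹ • x - intVec k‖ ≤ ‖k‖ / 2} with hD
  have hDm : MeasurableSet D :=
    (isClosed_le (by fun_prop) continuous_const).measurableSet
  have hGm : Measurable (D.indicator g) := hg.indicator hDm
  obtain ⟨i, hi⟩ := exists_norm_apply_eq_norm k
  have hkpos : 0 < ‖k‖ := norm_pos_iff.mpr hk
  rw [← lintegral_indicator hDm]
  calc _ = ∫⁻ b, D.indicator g (perturbedPoint lam b k)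
        ∂(Measure.pi fun _ : Fin d => unitBallMeasure d) := by
        refine lintegral_congr_ae ?_
        filter_upwards [ae_norm_le_one_of_unitBallMeasure] with b hb
        rw [Set.indicator_of_mem]
        exact norm_inv_smul_perturbedPoint_sub_le hlam hb k
    _ ≤ _ := by
        refine lintegral_pi_le_of_forall_update (hGm.comp (measurable_perturbedPoint lam k)) i
          fun b => ?_
        have h1 (v : EuclideanSpace ℝ (Fin d)) : perturbedPoint lam (Function.update b i v) k =
            (lam • intVec k + ∑ j ∈ Finset.univ.erase i, (lam * k j * (2 * d : ℝ)⁻¹) • b j) +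
              (lam * k i * (2 * d : ℝ)⁻¹) • v := by
          rw [perturbedPoint_eq, ← Finset.sum_erase_add _ _ (Finset.mem_univ i), add_assoc,
            Function.update_self]
          congr 2
          refine Finset.sum_congr rfl fun j hj => ?_
          rw [Function.update_of_ne (Finset.ne_of_mem_erase hj)]
        simp only [Function.comp_apply, h1]
        have hki : (k i : ℝ) ≠ 0 := by
          rw [← norm_ne_zero_iff, Int.norm_cast_real, hi]
          exact hkpos.ne'
        rw [unitBallMeasure, ProbabilityTheory.cond, lintegral_smul_measure, smul_eq_mul,
          mul_assoc (volume (Metric.closedBall (0 : EuclideanSpace ℝ (Fin d)) 1))⁻¹]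
        gcongr
        refine (lintegral_mono' Measure.restrict_le_self le_rfl).trans ?_
        rw [lintegral_add_smul volume hGm _ (by positivity), finrank_euclideanSpace_fin]
        refine le_of_eq ?_
        congr 2
        rw [abs_inv, abs_pow, abs_mul, abs_mul, abs_of_pos hlam,
          abs_of_pos (by positivity : 0 < (2 * d : ℝ)⁻¹), ← Real.norm_eq_abs, Int.norm_cast_real, hi]

/-- The number of nonzero lattice points at comparable distance is bounded after weighting. -/
lemma tsum_indicator_inv_norm_pow_le [NeZero d] (w : EuclideanSpace ℝ (Fin d)) :
    ∑' k : {k : Fin d → ℤ // k ≠ 0}, (if ‖w - intVec k.1‖ ≤ ‖k.1‖ / 2 then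
      ENNReal.ofReal ((‖k.1‖ ^ d)⁻¹) else 0) ≤ 9 ^ d := by
  classical
  set ρ : ℝ := ‖WithLp.ofLp w‖ with hρ
  have hcoord (k : Fin d → ℤ) (hk : ‖w - intVec k‖ ≤ ‖k‖ / 2) (i : Fin d) :
      |w i - k i| ≤ ‖k‖ / 2 :=
    (PiLp.norm_apply_le (w - intVec k) i).trans hk
  have hle (k : Fin d → ℤ) (hk : ‖w - intVec k‖ ≤ ‖k‖ / 2) : ‖k‖ ≤ 2 * ρ := by
    obtain ⟨i, hi⟩ := exists_norm_apply_eq_norm k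
    have h1 := hcoord k hk i
    have h2 : |w i| ≤ ρ := norm_le_pi_norm (WithLp.ofLp w) i
    rw [← Int.norm_cast_real, Real.norm_eq_abs] at hi
    have h3 : |(k i : ℝ)| ≤ |w i| + |w i - k i| := by
      have := abs_sub_abs_le_abs_sub (k i : ℝ) (w i)
      rw [abs_sub_comm] at this
      linarith
    linarith
  have hge (k : Fin d → ℤ) (hk : ‖w - intVec k‖ ≤ ‖k‖ / 2) : 2 * ρ ≤ 3 * ‖k‖ := by
    have : ρ ≤ 3 / 2 * ‖k‖ := by
      refine (pi_norm_le_iff_of_nonneg (by positivity)).mpr fun i => ?_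
      have h1 := hcoord k hk i
      have h2 : |(k i : ℝ)| ≤ ‖k‖ := by
        rw [← Real.norm_eq_abs, Int.norm_cast_real]; exact norm_le_pi_norm k i
      have h3 := abs_sub_abs_le_abs_sub (w i) (k i : ℝ)
      rw [Real.norm_eq_abs]
      linarith
    linarith
  have hone (k : Fin d → ℤ) (hk : k ≠ 0) : 1 ≤ ‖k‖ := by
    obtain ⟨i, hi⟩ := Function.ne_iff.mp hk
    refine le_trans ?_ (norm_le_pi_norm k i)
    rw [Int.norm_eq_abs]
    exact_mod_cast Int.one_le_abs hi
  -- Every contributing `k` has $2\rho/3\le\|k\|\le 2\rho$. There are at most $(2M+1)^d\le(6\rho)^d$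
  -- of them, each of weight at most $(2\rho/3)^{-d}$, whence $9^d$.
  set M : ℤ := ⌊2 * ρ⌋ with hM
  set B : Finset (Fin d → ℤ) := Fintype.piFinset fun _ => Finset.Icc (-M) M with hB
  have hmem (k : Fin d → ℤ) (hk : ‖w - intVec k‖ ≤ ‖k‖ / 2) : k ∈ B := by
    rw [hB, Fintype.mem_piFinset]
    intro i
    rw [Finset.mem_Icc, ← abs_le, hM, Int.le_floor]
    refine le_trans ?_ (hle k hk)
    rw [Int.cast_abs, ← Int.norm_eq_abs]
    exact norm_le_pi_norm k i
  by_cases hρ2 : 1 ≤ 2 * ρ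
  · have hM0 : 1 ≤ M := Int.le_floor.mpr (by simpa using hρ2)
    have hcard : (B.card : ℝ) ≤ (6 * ρ) ^ d := by
      rw [hB, Fintype.card_piFinset_const, Int.card_Icc, Nat.cast_pow]
      gcongr
      have h1 : (((M + 1 - -M).toNat : ℤ) : ℝ) = M + 1 - -M := by
        rw [Int.toNat_of_nonneg (by omega)]
        push_cast
        ring
      rw [Int.cast_natCast] at h1
      rw [h1]
      have := Int.floor_le (2 * ρ)
      rw [← hM] at this
      linarith
    calc _ ≤ ∑' k : {k : Fin d → ℤ // k ≠ 0}, (if k.1 ∈ B then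
            ENNReal.ofReal (((2 * ρ / 3) ^ d)⁻¹) else 0) := by
          refine ENNReal.tsum_le_tsum fun k => ?_
          split_ifs with h1 h2
          · refine ENNReal.ofReal_le_ofReal ?_
            gcongr
            have := hge k.1 h1
            linarith
          · exact absurd (hmem k.1 h1) h2
          · exact zero_le
          · exact le_rfl
      _ ≤ ∑' k : Fin d → ℤ, (if k ∈ B then ENNReal.ofReal (((2 * ρ / 3) ^ d)⁻¹) else 0) :=
          ENNReal.tsum_comp_le_tsum_of_injective Subtype.val_injective _
      _ = B.card * ENNReal.ofReal (((2 * ρ / 3) ^ d)⁻¹) := by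
          rw [tsum_eq_sum (s := B) (fun k hk => if_neg hk), Finset.sum_ite_mem, Finset.inter_self,
            Finset.sum_const, nsmul_eq_mul]
      _ ≤ ENNReal.ofReal ((6 * ρ) ^ d) * ENNReal.ofReal (((2 * ρ / 3) ^ d)⁻¹) := by
          gcongr
          rw [← ENNReal.ofReal_natCast]
          exact ENNReal.ofReal_le_ofReal hcard
      _ = 9 ^ d := by
          have hρ0 : 0 < ρ := by linarith
          rw [← ENNReal.ofReal_mul (by positivity), ← inv_pow, ← mul_pow,
            show 6 * ρ * (2 * ρ / 3)⁻¹ = 9 by field_simp; norm_num,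
            ENNReal.ofReal_pow (by norm_num)]
          norm_num
  · refine le_of_eq_of_le (ENNReal.tsum_eq_zero.mpr fun k => if_neg fun h => hρ2 ?_) zero_le
    exact (hone k.1 k.2).trans (hle k.1 h)

/-- The constant in the mean value inequality for the random lattice. -/
noncomputable def latticeConst (d : ℕ) : ℝ≥0∞ :=
  (volume (Metric.closedBall (0 : EuclideanSpace ℝ (Fin d)) 1))⁻¹ *
    ENNReal.ofReal ((2 * d : ℝ) ^ d) * 9 ^ d

lemma latticeConst_ne_top : latticeConst d ≠ ∞ := by
  unfold latticeConst
  have := (Metric.measure_closedBall_pos volume (0 : EuclideanSpace ℝ (Fin d)) one_pos).ne'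
  finiteness

/-- A **Siegel type mean value inequality** for the random lattice. -/
theorem lintegral_tsum_perturbedPoint_le [NeZero d] {lam : ℝ} (hlam : 0 < lam)
    {g : EuclideanSpace ℝ (Fin d) → ℝ≥0∞} (hg : Measurable g) :
    ∫⁻ b, ∑' k : {k : Fin d → ℤ // k ≠ 0}, g (perturbedPoint lam b k.1)
        ∂(Measure.pi fun _ : Fin d => unitBallMeasure d) ≤
      latticeConst d * ENNReal.ofReal ((lam ^ d)⁻¹) * ∫⁻ x, g x := by
  have hd : (0 : ℝ) < d := by exact_mod_cast Nat.pos_of_ne_zero (NeZero.ne d)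
  have hmeas (k : {k : Fin d → ℤ // k ≠ 0}) : AEMeasurable
      (fun b : Fin d → EuclideanSpace ℝ (Fin d) => g (perturbedPoint lam b k.1))
      (Measure.pi fun _ : Fin d => unitBallMeasure d) :=
    (hg.comp (measurable_perturbedPoint lam k.1)).aemeasurable
  rw [lintegral_tsum hmeas]
  obtain ⟨c, hc⟩ : ∃ c, c = (volume (Metric.closedBall (0 : EuclideanSpace ℝ (Fin d)) 1))⁻¹ *
    ENNReal.ofReal ((2 * d : ℝ) ^ d) * ENNReal.ofReal ((lam ^ d)⁻¹) := ⟨_, rfl⟩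
  have hDm (k : Fin d → ℤ) : MeasurableSet
      {x : EuclideanSpace ℝ (Fin d) | ‖lam⁻¹ • x - intVec k‖ ≤ ‖k‖ / 2} :=
    (isClosed_le (by fun_prop) continuous_const).measurableSet
  calc _ ≤ ∑' k : {k : Fin d → ℤ // k ≠ 0}, c * ∫⁻ x,
          (if ‖lam⁻¹ • x - intVec k.1‖ ≤ ‖k.1‖ / 2 then
            ENNReal.ofReal ((‖k.1‖ ^ d)⁻¹) else 0) * g x := by
        refine ENNReal.tsum_le_tsum fun k => (lintegral_perturbedPoint_le hlam hg k.2).trans_eq ?_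
        have h1 : ((lam * ‖k.1‖ * (2 * d : ℝ)⁻¹) ^ d)⁻¹ =
            (2 * d : ℝ) ^ d * (lam ^ d)⁻¹ * (‖k.1‖ ^ d)⁻¹ := by
          rw [mul_pow, mul_pow, inv_pow]
          field_simp
        have h2 : ∫⁻ x, (if ‖lam⁻¹ • x - intVec k.1‖ ≤ ‖k.1‖ / 2 then
            ENNReal.ofReal ((‖k.1‖ ^ d)⁻¹) else 0) * g x = ENNReal.ofReal ((‖k.1‖ ^ d)⁻¹) *
              ∫⁻ x in {x | ‖lam⁻¹ • x - intVec k.1‖ ≤ ‖k.1‖ / 2}, g x := by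
          rw [← lintegral_indicator (hDm k.1), ← lintegral_const_mul _ (hg.indicator (hDm k.1))]
          refine lintegral_congr fun x => ?_
          by_cases h : ‖lam⁻¹ • x - intVec k.1‖ ≤ ‖k.1‖ / 2 <;> simp [Set.indicator, h]
        rw [h2, h1, ENNReal.ofReal_mul (by positivity), ENNReal.ofReal_mul (by positivity), hc]
        ring
    _ = c * ∫⁻ x, (∑' k : {k : Fin d → ℤ // k ≠ 0},
          (if ‖lam⁻¹ • x - intVec k.1‖ ≤ ‖k.1‖ / 2 then
            ENNReal.ofReal ((‖k.1‖ ^ d)⁻¹) else 0)) * g x := by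
        rw [ENNReal.tsum_mul_left, ← lintegral_tsum fun k => ?_]
        · simp only [ENNReal.tsum_mul_right]
        · exact ((measurable_const.ite (hDm k.1) measurable_const).mul hg).aemeasurable
    _ ≤ c * ∫⁻ x, 9 ^ d * g x := by
        gcongr with x
        exact tsum_indicator_inv_norm_pow_le _
    _ = _ := by
        rw [lintegral_const_mul _ hg, hc, latticeConst]
        ring

/-- Some lattice of the random family is good for two functions at the same time. -/
theorem exists_perturbedPoint_tsum_le [NeZero d] {lam : ℝ} (hlam : 0 < lam)
    {g₁ g₂ : EuclideanSpace ℝ (Fin d) → ℝ≥0∞} (hg₁ : Measurable g₁) (hg₂ : Measurable g₂)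
    {I₁ I₂ : ℝ≥0∞} (h₁ : ∫⁻ x, g₁ x ≤ I₁) (h₂ : ∫⁻ x, g₂ x ≤ I₂) (h₁0 : I₁ ≠ 0) (h₁t : I₁ ≠ ∞)
    (h₂0 : I₂ ≠ 0) (h₂t : I₂ ≠ ∞) :
    ∃ b : Fin d → EuclideanSpace ℝ (Fin d), (∀ i, ‖b i‖ ≤ 1) ∧
      ∑' k : {k : Fin d → ℤ // k ≠ 0}, g₁ (perturbedPoint lam b k.1) ≤
        2 * latticeConst d * ENNReal.ofReal ((lam ^ d)⁻¹) * I₁ ∧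
      ∑' k : {k : Fin d → ℤ // k ≠ 0}, g₂ (perturbedPoint lam b k.1) ≤
        2 * latticeConst d * ENNReal.ofReal ((lam ^ d)⁻¹) * I₂ := by
  -- Normalizing both functions lets one lattice, no worse than average for the sum, serve for each
  -- at the cost of a factor 2.
  set g : EuclideanSpace ℝ (Fin d) → ℝ≥0∞ := fun x => I₁⁻¹ * g₁ x + I₂⁻¹ * g₂ x with hg
  have hgm : Measurable g := by fun_prop
  have hint : ∫⁻ x, g x ≤ 2 := by
    rw [hg, lintegral_add_left (by fun_prop), lintegral_const_mul _ hg₁, lintegral_const_mul _ hg₂]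
    calc _ ≤ I₁⁻¹ * I₁ + I₂⁻¹ * I₂ := by gcongr
      _ = 2 := by
        rw [ENNReal.inv_mul_cancel h₁0 h₁t, ENNReal.inv_mul_cancel h₂0 h₂t, one_add_one_eq_two]
  have hmeas : Measurable fun b : Fin d → EuclideanSpace ℝ (Fin d) =>
      ∑' k : {k : Fin d → ℤ // k ≠ 0}, g (perturbedPoint lam b k.1) :=
    Measurable.tsum fun k => hgm.comp (measurable_perturbedPoint lam k.1)
  obtain ⟨b, hb, hle⟩ := exists_notMem_null_le_lintegral
    (μ := Measure.pi fun _ : Fin d => unitBallMeasure d) hmeas.aemeasurable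
    (N := {b | ¬ ∀ i, ‖b i‖ ≤ 1}) ae_norm_le_one_of_unitBallMeasure
  have hsum := hle.trans ((lintegral_tsum_perturbedPoint_le hlam hgm).trans
    (mul_le_mul_right hint _))
  simp only [hg, ENNReal.tsum_add, ENNReal.tsum_mul_left] at hsum
  refine ⟨b, of_not_not hb, ?_, ?_⟩
  · have h3 := le_self_add.trans hsum
    rw [ENNReal.inv_mul_le_iff h₁0 h₁t] at h3
    refine h3.trans_eq (by ring)
  · have h3 := le_add_self.trans hsum
    rw [ENNReal.inv_mul_le_iff h₂0 h₂t] at h3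
    refine h3.trans_eq (by ring)

end RandomLattice

/-! ### Projection to the torus and lattice coordinates -/

namespace UnitAddTorus

variable {d : ℕ}

/-- The quotient map from `ℝ^d` to the torus. -/
def proj (x : Fin d → ℝ) : UnitAddTorus (Fin d) := fun i => (x i : UnitAddCircle)

lemma continuous_proj : Continuous (proj (d := d)) :=
  continuous_pi fun i => (AddCircle.continuous_mk' (1 : ℝ)).comp (continuous_apply i)

lemma isOpenMap_proj : IsOpenMap (proj (d := d)) :=
  IsOpenMap.piMap (fun _ => QuotientAddGroup.isOpenMap_coe)
    (Filter.Eventually.of_forall fun _ => QuotientAddGroup.mk_surjective)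

/-- The quotient map to the torus does not increase volumes. -/
lemma volume_image_proj_le {U : Set (Fin d → ℝ)} (hU : IsOpen U) :
    volume (proj '' U) ≤ volume U := by
  set Q : Set (Fin d → ℝ) := {x | ∀ i, x i ∈ Set.Ioc ((0 : Fin d → ℝ) i) ((0 : Fin d → ℝ) i + 1)}
    with hQ
  have hQm : MeasurableSet Q := MeasurableSet.univ_pi' fun i => measurableSet_Ioc
  have hVm : MeasurableSet (proj '' U) := (isOpenMap_proj U hU).measurableSet
  have hpm : Measurable (proj (d := d)) := continuous_proj.measurable
  let j : (Fin d → ℤ) → Fin d → ℝ := fun k i => (k i : ℝ)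
  have h1 : volume (proj '' U) = volume (Q ∩ proj ⁻¹' (proj '' U)) := by
    rw [← lintegral_indicator_one hVm, lintegral_preimage _ 0, ← hQ, Set.inter_comm,
      ← Measure.restrict_apply (hpm hVm), ← lintegral_indicator_one (hpm hVm)]
    rfl
  -- The pieces of `U` in the integer translates of the unit cube `Q` are disjoint, and moved back
  -- into `Q` they cover the image.
  have h2 : Q ∩ proj ⁻¹' (proj '' U) ⊆ ⋃ k, (· + j k) ⁻¹' ((· - j k) ⁻¹' Q ∩ U) := by
    rintro x ⟨hxQ, u, hu, hux⟩
    have (i : Fin d) : ∃ n : ℤ, u i = x i + n := by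
      have hi := congrFun hux i
      simp only [proj] at hi
      rw [← sub_eq_zero, ← AddCircle.coe_sub, AddCircle.coe_eq_zero_iff] at hi
      obtain ⟨n, hn⟩ := hi
      rw [zsmul_one] at hn
      exact ⟨n, by linarith⟩
    choose k hk using this
    refine Set.mem_iUnion.mpr ⟨k, ?_, ?_⟩
    · simpa using hxQ
    · convert hu using 1
      exact funext fun i => (hk i).symm
  rw [h1]
  calc _ ≤ ∑' k, volume ((· + j k) ⁻¹' ((· - j k) ⁻¹' Q ∩ U)) :=
        (measure_mono h2).trans (measure_iUnion_le _)
    _ = ∑' k, volume ((· - j k) ⁻¹' Q ∩ U) := by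
        simp only [measure_preimage_add_right]
    _ = volume (⋃ k, (· - j k) ⁻¹' Q ∩ U) := by
        refine (measure_iUnion (fun k l hkl => ?_) fun k =>
          ((measurable_sub_const (j k)) hQm).inter hU.measurableSet).symm
        refine Set.disjoint_left.mpr fun x hx hy => hkl (funext fun i => ?_)
        have h3 := hx.1 i
        have h4 := hy.1 i
        simp only [j, Pi.sub_apply, Pi.zero_apply, zero_add, Set.mem_Ioc] at h3 h4
        have h5 : (k i : ℝ) < l i + 1 := by linarith
        have h6 : (l i : ℝ) < k i + 1 := by linarith
        norm_cast at h5 h6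
        omega
    _ ≤ volume U := measure_mono (Set.iUnion_subset fun k => Set.inter_subset_right)

end UnitAddTorus

section Coordinates

variable {d : ℕ}

/-- The inner products of a vector with the members of a family. -/
noncomputable def innerCoords (a : Fin d → EuclideanSpace ℝ (Fin d)) (x : EuclideanSpace ℝ (Fin d)) :
    Fin d → ℝ :=
  fun i => inner ℝ (a i) x

lemma continuous_innerCoords (a : Fin d → EuclideanSpace ℝ (Fin d)) :
    Continuous (innerCoords a) := by
  unfold innerCoords
  fun_prop

lemma volume_image_innerCoords_le {a : Fin d → EuclideanSpace ℝ (Fin d)} {B : ℝ}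
    (hB : ∀ i j, |a i j| ≤ B) (s : Set (EuclideanSpace ℝ (Fin d))) :
    volume (innerCoords a '' s) ≤ ENNReal.ofReal (d.factorial * B ^ d) * volume s := by
  set M : Matrix (Fin d) (Fin d) ℝ := Matrix.of fun i j => a i j with hM
  have h1 : innerCoords a '' s = Matrix.toLin' M '' ((MeasurableEquiv.toLp 2 (Fin d → ℝ)).symm '' s) := by
    rw [Set.image_image]
    refine Set.image_congr fun x _ => funext fun i => ?_
    simp only [innerCoords, PiLp.inner_apply, Matrix.toLin'_apply, Matrix.mulVec, dotProduct, hM]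
    refine Finset.sum_congr rfl fun j _ => ?_
    simp [mul_comm]
  have h2 : volume ((MeasurableEquiv.toLp 2 (Fin d → ℝ)).symm '' s) = volume s := by
    rw [MeasurableEquiv.image_eq_preimage_symm]
    exact (PiLp.volume_preserving_toLp (Fin d)).measure_preimage_equiv
      (f := MeasurableEquiv.toLp 2 (Fin d → ℝ)) s
  rw [h1, Measure.addHaar_image_linearMap, h2, LinearMap.det_toLin']
  gcongr
  have := Matrix.det_le (A := M) (abv := AbsoluteValue.abs) (x := B) hB
  simpa using this


lemma abs_perturbedBasis_le [NeZero d] {lam : ℝ} (hlam : 0 < lam)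
    {b : Fin d → EuclideanSpace ℝ (Fin d)} (hb : ∀ i, ‖b i‖ ≤ 1) (i j : Fin d) :
    |perturbedBasis lam b i j| ≤ 2 * lam := by
  have hd : (1 : ℝ) ≤ d := by exact_mod_cast Nat.one_le_iff_ne_zero.mpr (NeZero.ne d)
  have h1 : ‖perturbedBasis lam b i‖ ≤ 2 * lam := by
    rw [perturbedBasis, norm_smul, Real.norm_of_nonneg hlam.le, mul_comm]
    gcongr
    refine (norm_add_le _ _).trans ?_
    rw [PiLp.norm_single, norm_one, norm_smul, Real.norm_of_nonneg (by positivity)]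
    have h2 : (2 * d : ℝ)⁻¹ ≤ 1 := inv_le_one_of_one_le₀ (by linarith)
    have := mul_le_one₀ h2 (norm_nonneg _) (hb i)
    linarith
  exact (PiLp.norm_apply_le (perturbedBasis lam b i) j).trans h1

lemma inner_perturbedPoint (lam : ℝ) (b : Fin d → EuclideanSpace ℝ (Fin d)) (k : Fin d → ℤ)
    (x : EuclideanSpace ℝ (Fin d)) :
    inner ℝ x (perturbedPoint lam b k) = ∑ i, k i * innerCoords (perturbedBasis lam b) x i := by
  simp only [perturbedPoint, inner_sum, inner_smul_right, innerCoords, real_inner_comm x]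

/-- Values on the translated lattice are the Fourier coefficients of the pushforward of $F$ times a
phase. -/
lemma fourier_add_perturbedPoint (F : EuclideanSpace ℝ (Fin d) → ℂ) (lam : ℝ)
    (b : Fin d → EuclideanSpace ℝ (Fin d)) (y : EuclideanSpace ℝ (Fin d)) (k : Fin d → ℤ) :
    𝓕 F (y + perturbedPoint lam b k) = ∫ x, (Complex.exp (↑(-2 * Real.pi * inner ℝ x y) * Complex.I) * F x) *
      UnitAddTorus.mFourier (-k) (UnitAddTorus.proj (innerCoords (perturbedBasis lam b) x)) := by
  rw [Real.fourier_eq']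
  refine integral_congr_ae (Filter.Eventually.of_forall fun x => ?_)
  simp only [smul_eq_mul, inner_add_right, inner_perturbedPoint, UnitAddTorus.mFourier,
    UnitAddTorus.proj, ContinuousMap.coe_mk, fourier_coe_apply, Pi.neg_apply]
  rw [← Complex.exp_sum, mul_right_comm (Complex.exp _), ← Complex.exp_add]
  congr 2
  push_cast
  rw [mul_add, add_mul, Finset.mul_sum, Finset.sum_mul]
  congr 1
  refine Finset.sum_congr rfl fun i _ => ?_
  ring

end Coordinates

/-! ### The pointwise uncertainty principle -/

/-- The lower bound for values of a function with spectrum in `Sig` on a lattice. -/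
lemma sq_enorm_fourier_le_tsum {d : ℕ} [NeZero d] {F : EuclideanSpace ℝ (Fin d) → ℂ}
    (hF : Integrable F) {Sig : Set (EuclideanSpace ℝ (Fin d))}
    (hFS : ∀ᵐ x, x ∉ Sig → F x = 0) {lam : ℝ} (hlam : 0 < lam)
    (hSig : ENNReal.ofReal (d.factorial * (2 * lam) ^ d) * volume Sig < 1 / 2)
    {b : Fin d → EuclideanSpace ℝ (Fin d)} (hb : ∀ i, ‖b i‖ ≤ 1) (y : EuclideanSpace ℝ (Fin d))
    {N : Finset (Fin d → ℤ)} (h0 : 0 ∈ N) :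
    ‖𝓕 F y‖ₑ ^ 2 ≤ 16 * 256 ^ N.card *
      ∑' k, if k ∈ N then 0 else ‖𝓕 F (y + perturbedPoint lam b k)‖ₑ ^ 2 := by
  have himg := (volume_image_innerCoords_le (abs_perturbedBasis_le hlam hb) Sig).trans_lt hSig
  -- An open neighbourhood replaces the image of `Sig` so that `E` is closed.
  obtain ⟨U, hSU, hU, hU2⟩ := Set.exists_isOpen_lt_of_lt _ _ himg
  set E : Set (UnitAddTorus (Fin d)) := (UnitAddTorus.proj '' U)ᶜ with hE
  have hEc : IsClosed E := (UnitAddTorus.isOpenMap_proj U hU).isClosed_compl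
  have hE2 : 1 / 2 ≤ volume.real E := by
    have h1 : volume.real (UnitAddTorus.proj '' U) ≤ 1 / 2 := by
      have := (UnitAddTorus.volume_image_proj_le hU).trans hU2.le
      simpa [Measure.real] using ENNReal.toReal_mono (by simp) this
    rw [hE, probReal_compl_eq_one_sub (UnitAddTorus.isOpenMap_proj U hU).measurableSet]
    linarith
  have hphase : Integrable fun x =>
      Complex.exp (↑(-2 * Real.pi * inner ℝ x y) * Complex.I) * F x := by
    refine hF.bdd_mul (c := 1) (Continuous.aestronglyMeasurable (by fun_prop))
      (Filter.Eventually.of_forall fun x => ?_)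
    rw [Complex.norm_exp_ofReal_mul_I]
  have hzero : perturbedPoint lam b 0 = 0 := by simp [perturbedPoint]
  have := UnitAddTorus.sq_enorm_coeff_zero_le_tsum hphase
    (UnitAddTorus.continuous_proj.comp (continuous_innerCoords (perturbedBasis lam b))).measurable
    hEc hE2 ?_ (fourier_add_perturbedPoint F lam b y) h0
  · simpa only [hzero, add_zero] using this
  · filter_upwards [hFS] with x hx hxE
    rw [hx fun hxS => hxE ⟨_, hSU ⟨x, hxS, rfl⟩, rfl⟩, mul_zero]

/-- Nazarov's uncertainty principle, in a pointwise form. -/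
theorem exists_sq_enorm_fourier_le_setLIntegral (d : ℕ) [NeZero d] :
    ∃ K : ℝ, 0 < K ∧ ∀ F : EuclideanSpace ℝ (Fin d) → ℂ, Integrable F →
      ∀ (Sig : Set (EuclideanSpace ℝ (Fin d))) (σ : ℝ), 0 < σ → volume Sig = ENNReal.ofReal σ →
      (∀ᵐ x, x ∉ Sig → F x = 0) →
      ∀ (S : Set (EuclideanSpace ℝ (Fin d))) (m : ℝ), MeasurableSet S → 0 ≤ m →
        volume S ≤ ENNReal.ofReal m → ∀ y,
          ‖𝓕 F y‖ₑ ^ 2 ≤ ENNReal.ofReal (K * σ * Real.exp (K * (m * σ))) *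
            ∫⁻ x in Sᶜ, ‖𝓕 F x‖ₑ ^ 2 := by
  set q : ℝ := 4 * d.factorial * 2 ^ d with hq
  have hq0 : 0 < q := by positivity
  set κ : ℝ := (2 * latticeConst d).toReal * q with hκ
  have hκ0 : 0 ≤ κ := by positivity
  refine ⟨16 * Real.exp (6 * (1 + κ)) * (κ + 1) + 6 * κ, by positivity,
    fun F hF Sig σ hσ hSig hFS S m hS hm hSm y => ?_⟩
  set J := ∫⁻ x in Sᶜ, ‖𝓕 F x‖ₑ ^ 2 with hJ
  rcases eq_or_ne J ∞ with hJt | hJt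
  · rw [hJt, ENNReal.mul_top (by simp; positivity)]
    exact le_top
  have hcont : Continuous (𝓕 F) := VectorFourier.fourierIntegral_continuous
    Real.continuous_fourierChar continuous_inner hF
  -- This scale makes the volume bound $d!\,(2\lambda)^d\sigma$ equal to $1/4$.
  obtain ⟨lam, hlam, hlamd⟩ : ∃ lam : ℝ, 0 < lam ∧ lam ^ d = (q * σ)⁻¹ :=
    ⟨((q * σ)⁻¹) ^ (1 / d : ℝ), by positivity, by
      rw [← Real.rpow_natCast, ← Real.rpow_mul (by positivity),
        one_div_mul_cancel (by exact_mod_cast NeZero.ne d), Real.rpow_one]⟩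
  have hsmall : ENNReal.ofReal (d.factorial * (2 * lam) ^ d) * volume Sig < 1 / 2 := by
    rw [hSig, ← ENNReal.ofReal_mul (by positivity), mul_pow, hlamd, hq]
    have : (d.factorial : ℝ) * (2 ^ d * (4 * d.factorial * 2 ^ d * σ)⁻¹) * σ = 1 / 4 := by
      have : (d.factorial : ℝ) ≠ 0 := by positivity
      field_simp
    rw [this, ← ENNReal.ofReal_one, ← ENNReal.ofReal_ofNat 2,
      ← ENNReal.ofReal_div_of_pos (by norm_num), ENNReal.ofReal_lt_ofReal_iff (by norm_num)]
    norm_num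
  have hconst : 2 * latticeConst d * ENNReal.ofReal ((lam ^ d)⁻¹) = ENNReal.ofReal (κ * σ) := by
    rw [hlamd, inv_inv, hκ, mul_assoc (ENNReal.toReal _), ENNReal.ofReal_mul ENNReal.toReal_nonneg,
      ENNReal.ofReal_toReal (ENNReal.mul_ne_top (by simp) latticeConst_ne_top)]
  set g₁ : EuclideanSpace ℝ (Fin d) → ℝ≥0∞ := fun x => S.indicator 1 (y + x) with hg₁
  set g₂ : EuclideanSpace ℝ (Fin d) → ℝ≥0∞ := fun x =>
    Sᶜ.indicator (fun z => ‖𝓕 F z‖ₑ ^ 2) (y + x) with hg₂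
  have hm₁ : Measurable (S.indicator (1 : EuclideanSpace ℝ (Fin d) → ℝ≥0∞)) :=
    measurable_one.indicator hS
  have hm₂ : Measurable (Sᶜ.indicator (fun z => ‖𝓕 F z‖ₑ ^ 2)) :=
    (hcont.measurable.enorm.pow_const 2).indicator hS.compl
  -- The extra $\sigma^{-1}$ keeps the bound nonzero when $m=0$ and only adds a constant to the
  -- count $\kappa\sigma(m+\sigma^{-1})$. Likewise `δ` below covers $J=0$ and then tends to 0.
  have hi₁ : ∫⁻ x, g₁ x ≤ ENNReal.ofReal (m + σ⁻¹) := by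
    rw [hg₁, lintegral_add_left_eq_self (S.indicator 1) y, lintegral_indicator_one hS]
    exact hSm.trans (ENNReal.ofReal_le_ofReal (by have := inv_pos.mpr hσ; linarith))
  have hi₂ : ∫⁻ x, g₂ x = J := by
    rw [hg₂, lintegral_add_left_eq_self (Sᶜ.indicator fun z => ‖𝓕 F z‖ₑ ^ 2) y,
      lintegral_indicator hS.compl]
  have hle (δ : ℝ≥0∞) (hδ : δ ≠ 0) (hδt : δ ≠ ∞) : ‖𝓕 F y‖ₑ ^ 2 ≤
      ENNReal.ofReal (16 * 256 ^ (1 + κ * (1 + m * σ)) * (κ * σ)) * (J + δ) := by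
    obtain ⟨b, hb, hb₁, hb₂⟩ := exists_perturbedPoint_tsum_le hlam
      (hm₁.comp (measurable_const_add y)) (hm₂.comp (measurable_const_add y)) hi₁
      (hi₂.trans_le (le_self_add (b := δ))) (by simp; positivity) ENNReal.ofReal_ne_top
      (by simp [hδ]) (by simp [hJt, hδt])
    rw [hconst] at hb₁ hb₂
    rw [← ENNReal.ofReal_mul (by positivity)] at hb₁
    have hmσ : κ * σ * (m + σ⁻¹) = κ * (1 + m * σ) := by field_simp; ring
    rw [hmσ] at hb₁
    obtain ⟨hfin, hcard⟩ := ENNReal.finset_card_const_le_le_of_tsum_le ENNReal.ofReal_ne_top hb₁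
      one_ne_zero
    rw [div_one, ← ENNReal.ofReal_natCast, ENNReal.ofReal_le_ofReal_iff (by positivity)] at hcard
    classical
    -- The index 0 of `y`, together with all indices whose lattice point lies in `S`.
    set N : Finset (Fin d → ℤ) := insert 0 (hfin.toFinset.image Subtype.val) with hN
    have hNcard : (N.card : ℝ) ≤ 1 + κ * (1 + m * σ) := by
      have h1 : N.card ≤ hfin.toFinset.card + 1 :=
        (Finset.card_insert_le _ _).trans (Nat.add_le_add_right Finset.card_image_le 1)
      have h2 : (N.card : ℝ) ≤ hfin.toFinset.card + 1 := by exact_mod_cast h1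
      linarith
    have hsum : ∑' k, (if k ∈ N then 0 else ‖𝓕 F (y + perturbedPoint lam b k)‖ₑ ^ 2) ≤
        ENNReal.ofReal (κ * σ) * (J + δ) := by
      refine le_trans ?_ hb₂
      rw [← tsum_subtype_eq_of_support_subset (s := {k : Fin d → ℤ | k ≠ 0}) ?_]
      · refine ENNReal.tsum_le_tsum fun k => ?_
        split_ifs with hk
        · exact zero_le
        · simp only [Function.comp_apply]
          rw [Set.indicator_of_mem]
          intro hkS
          refine hk (Finset.mem_insert_of_mem (Finset.mem_image.mpr ⟨k, ?_, rfl⟩))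
          rw [Set.Finite.mem_toFinset]
          simp only [Set.mem_ofPred_eq, Function.comp_apply]
          rw [Set.indicator_of_mem hkS]
          exact le_rfl
      · intro k hk hk0
        simp only [Function.mem_support, ne_eq, ite_eq_left_iff, Classical.not_imp] at hk
        exact hk.1 (hk0 ▸ Finset.mem_insert_self _ _)
    refine (sq_enorm_fourier_le_tsum hF hFS hlam hsmall hb y
      (Finset.mem_insert_self 0 _ : (0 : Fin d → ℤ) ∈ N)).trans ?_
    rw [ENNReal.ofReal_mul (by positivity), mul_assoc (ENNReal.ofReal _)]
    refine mul_le_mul' ?_ hsum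
    rw [ENNReal.ofReal_mul (by norm_num)]
    refine mul_le_mul' ?_ ?_
    · norm_num
    · rw [show (256 : ℝ≥0∞) = ENNReal.ofReal 256 by norm_num, ← ENNReal.ofReal_pow (by norm_num),
        ← Real.rpow_natCast]
      exact ENNReal.ofReal_le_ofReal (Real.rpow_le_rpow_of_exponent_le (by norm_num) hNcard)
  have hlim : ‖𝓕 F y‖ₑ ^ 2 ≤
      ENNReal.ofReal (16 * 256 ^ (1 + κ * (1 + m * σ)) * (κ * σ)) * J := by
    have hseq : Filter.Tendsto (fun n : ℕ => (n : ℝ≥0∞)⁻¹) Filter.atTop (nhds 0) :=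
      ENNReal.tendsto_inv_nat_nhds_zero
    have h1 := ENNReal.Tendsto.const_mul
      (a := ENNReal.ofReal (16 * 256 ^ (1 + κ * (1 + m * σ)) * (κ * σ)))
      (hseq.const_add J) (Or.inr ENNReal.ofReal_ne_top)
    rw [add_zero] at h1
    refine ge_of_tendsto h1 ?_
    filter_upwards [Filter.eventually_ge_atTop 1] with n hn
    exact hle _ (by simp) (by simp; omega)
  refine hlim.trans (mul_le_mul' (ENNReal.ofReal_le_ofReal ?_) le_rfl)
  have hexp : (256 : ℝ) ^ (1 + κ * (1 + m * σ)) ≤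
      Real.exp (6 * (1 + κ)) * Real.exp (6 * κ * (m * σ)) := by
    have h256 : (256 : ℝ) ≤ Real.exp 6 := by
      have h1 : (2.7 : ℝ) ≤ Real.exp 1 := by linarith [Real.exp_one_gt_d9]
      calc (256 : ℝ) ≤ 2.7 ^ 6 := by norm_num
        _ ≤ Real.exp 1 ^ 6 := by gcongr
        _ = Real.exp 6 := by rw [Real.exp_one_pow]; norm_num
    rw [← Real.exp_add, show 6 * (1 + κ) + 6 * κ * (m * σ) = 6 * (1 + κ * (1 + m * σ)) by ring,
      Real.exp_mul]
    exact Real.rpow_le_rpow (by norm_num) h256 (by positivity)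
  set X := Real.exp (6 * (1 + κ)) with hX
  have hX0 : 0 < X := Real.exp_pos _
  have h1 : Real.exp (6 * κ * (m * σ)) ≤ Real.exp ((16 * X * (κ + 1) + 6 * κ) * (m * σ)) := by
    have : 0 ≤ 16 * X * (κ + 1) := by positivity
    gcongr
    linarith
  calc 16 * 256 ^ (1 + κ * (1 + m * σ)) * (κ * σ)
      ≤ 16 * (X * Real.exp (6 * κ * (m * σ))) * (κ * σ) := by gcongr
    _ = (16 * X * κ) * σ * Real.exp (6 * κ * (m * σ)) := by ring
    _ ≤ (16 * X * (κ + 1) + 6 * κ) * σ * Real.exp ((16 * X * (κ + 1) + 6 * κ) * (m * σ)) := by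
        gcongr
        nlinarith

/-! ### Functions with spectrum in a set of finite measure -/

section Spectrum

variable {d : ℕ}

lemma locallyIntegrable_of_integrable_mul_schwartz {f : EuclideanSpace ℝ (Fin d) → ℂ}
    (hf : ∀ φ : 𝓢(EuclideanSpace ℝ (Fin d), ℂ), Integrable fun x => f x * φ x) :
    LocallyIntegrable f := by
  intro x
  let β : ContDiffBump x := default
  have hc : ContDiff ℝ ((⊤ : ℕ∞) : WithTop ℕ∞) fun y => (β y : ℂ) := Complex.ofRealCLM.contDiff.comp β.contDiff
  have hs : HasCompactSupport fun y => (β y : ℂ) :=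
    β.hasCompactSupport.comp_left (g := Complex.ofReal) Complex.ofReal_zero
  refine ⟨Metric.closedBall x β.rIn, Metric.closedBall_mem_nhds x β.rIn_pos, ?_⟩
  refine ((hf (hs.toSchwartzMap hc)).integrableOn (s := Metric.closedBall x β.rIn)).congr_fun
    (fun y hy => ?_) Metric.isClosed_closedBall.measurableSet
  simp [β.one_of_mem_closedBall hy]

lemma integral_mul_schwartz_fourier {F : EuclideanSpace ℝ (Fin d) → ℂ} (hF : Integrable F)
    (ψ : 𝓢(EuclideanSpace ℝ (Fin d), ℂ)) :
    ∫ x, 𝓕 F x * ψ x = ∫ x, F x * (𝓕 ψ : 𝓢(EuclideanSpace ℝ (Fin d), ℂ)) x := by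
  have h := VectorFourier.integral_fourierIntegral_smul_eq_flip (μ := volume) (ν := volume)
    (L := innerₗ (EuclideanSpace ℝ (Fin d))) Real.continuous_fourierChar continuous_inner hF
    (ψ.integrable (μ := volume))
  rw [flip_innerₗ] at h
  exact h

/-- A function whose Fourier transform is an integrable function `F` is almost everywhere equal to
the inverse transform of `F`. -/
lemma IsFourierTransform.ae_eq_fourier {f F : EuclideanSpace ℝ (Fin d) → ℂ}
    (h : IsFourierTransform f F) (hF : Integrable F) : f =ᵐ[volume] 𝓕 F := by
  have hcont : Continuous (𝓕 F) := VectorFourier.fourierIntegral_continuous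
    Real.continuous_fourierChar continuous_inner hF
  have hinv (ψ : 𝓢(EuclideanSpace ℝ (Fin d), ℂ)) :
      (𝓕⁻ (𝓕 ψ : 𝓢(EuclideanSpace ℝ (Fin d), ℂ)) : 𝓢(EuclideanSpace ℝ (Fin d), ℂ)) = ψ :=
    FourierTransform.fourierInv_fourier_eq ψ
  have hloc : LocallyIntegrable f := locallyIntegrable_of_integrable_mul_schwartz fun ψ => by
    have := (h (𝓕 ψ)).1
    rwa [hinv] at this
  refine ae_eq_of_integral_contDiff_smul_eq hloc hcont.locallyIntegrable fun g hg hgs => ?_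
  have hc : ContDiff ℝ ((⊤ : ℕ∞) : WithTop ℕ∞) fun y => (g y : ℂ) := Complex.ofRealCLM.contDiff.comp hg
  have hs : HasCompactSupport fun y => (g y : ℂ) :=
    hgs.comp_left (g := Complex.ofReal) Complex.ofReal_zero
  set ψ := hs.toSchwartzMap hc with hψ
  -- Testing with `𝓕 ψ` moves the transform onto `F`, so `f` and `𝓕 F` agree as distributions.
  have h1 := (h (𝓕 ψ)).2.2
  rw [hinv, ← integral_mul_schwartz_fourier hF] at h1
  have hψg (x) : ψ x = (g x : ℂ) := rfl
  simp only [Complex.real_smul]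
  simpa only [hψg, mul_comm] using h1

/-- A function with spectrum in a set of finite measure is almost everywhere equal to the
transform of an integrable function. -/
lemma HasSpectrumIn.exists_ae_eq_fourier {f : EuclideanSpace ℝ (Fin d) → ℂ}
    {Sig : Set (EuclideanSpace ℝ (Fin d))} (h : HasSpectrumIn f Sig) (hSig : volume Sig ≠ ∞) :
    ∃ F : EuclideanSpace ℝ (Fin d) → ℂ, Integrable F ∧ (∀ᵐ x, x ∉ Sig → F x = 0) ∧
      f =ᵐ[volume] 𝓕 F := by
  obtain ⟨F, ⟨s, hs, hF⟩, hfF, hz⟩ := h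
  have : Fact (volume (toMeasurable volume Sig) < ∞) :=
    ⟨by rw [measure_toMeasurable]; exact hSig.lt_top⟩
  -- On a set of finite measure, $L^s\subset L^1$ for $s\ge 1$.
  have h1 : IntegrableOn F (toMeasurable volume Sig) :=
    memLp_one_iff_integrable.mp ((hF.restrict _).mono_exponent hs)
  have h2 : Integrable F := h1.integrable_of_ae_notMem_eq_zero (by
    filter_upwards [hz] with x hx hxs
    exact hx fun hxS => hxs (subset_toMeasurable _ _ hxS))
  exact ⟨F, h2, hz, hfF.ae_eq_fourier h2⟩

end Spectrum

/-! ### From quadratic means to $L^p$, and the theorem -/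

/-- The passage from quadratic means to means of order `p`. -/
lemma setLIntegral_rpow_le_of_sq_le {E : Type*} [MeasurableSpace E] {μ : Measure E}
    {u : E → ℝ≥0∞} (hu : Measurable u) {S : Set E} (hS : MeasurableSet S) (hS0 : μ S ≠ 0)
    (hSt : μ S ≠ ∞) {p : ℝ} (hp : 0 < p) (hp2 : p < 2) (hfin : ∫⁻ x in Sᶜ, u x ^ p ∂μ ≠ ∞)
    {K : ℝ≥0∞} (h : ∀ S', MeasurableSet S' → μ S' ≤ 2 * μ S →
      ∀ y, u y ^ 2 ≤ K * ∫⁻ x in S'ᶜ, u x ^ 2 ∂μ) :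
    ∫⁻ x in S, u x ^ p ∂μ ≤ (K * μ S) ^ (p / 2) * ∫⁻ x in Sᶜ, u x ^ p ∂μ := by
  set A := ∫⁻ x in Sᶜ, u x ^ p ∂μ with hA
  have hum : Measurable fun x => u x ^ p := hu.pow_const p
  -- At this level Chebyshev gives $\mu(T)\le\mu(S)$. Off $S\cup T$ one has $u\le\lambda$, so $\int
  -- u^2\le\lambda^{2-p}A$ there.
  obtain ⟨lam, hlamp⟩ : ∃ lam : ℝ≥0∞, lam ^ p = A / μ S :=
    ⟨(A / μ S) ^ (1 / p), by rw [← ENNReal.rpow_mul, one_div_mul_cancel hp.ne', ENNReal.rpow_one]⟩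
  set T : Set E := {x | lam < u x} ∩ Sᶜ with hT
  have hTm : MeasurableSet T := (measurableSet_lt measurable_const hu).inter hS.compl
  have hTS : μ T ≤ μ S := by
    rcases eq_or_ne A 0 with hA0 | hA0
    · have h1 : ∀ᵐ x ∂μ.restrict Sᶜ, u x ^ p = 0 := (lintegral_eq_zero_iff hum).mp hA0
      rw [ae_restrict_iff' hS.compl] at h1
      have : μ T = 0 := by
        refine measure_mono_null (fun x hx => ?_) h1
        simp only [Set.mem_compl_iff, Set.mem_ofPred_eq, Classical.not_imp]
        refine ⟨hx.2, fun h0 => ?_⟩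
        have h2 : u x = 0 := (ENNReal.rpow_eq_zero_iff_of_pos hp).mp h0
        exact (not_lt_zero (hx.1.trans_eq h2)).elim
      rw [this]
      exact zero_le
    · have h1 := mul_meas_ge_le_lintegral (μ := μ.restrict Sᶜ) hum (A / μ S)
      have h2 : μ T ≤ μ.restrict Sᶜ {x | A / μ S ≤ u x ^ p} := by
        rw [hT, ← Measure.restrict_apply' hS.compl]
        refine measure_mono fun x hx => ?_
        rw [Set.mem_ofPred_eq, ← hlamp]
        exact ENNReal.rpow_le_rpow (le_of_lt hx) hp.le
      have h3 : A / μ S * μ T ≤ A := (mul_le_mul_right h2 _).trans h1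
      rw [← ENNReal.mul_le_mul_iff_right (ENNReal.div_ne_zero.mpr ⟨hA0, hSt⟩)
        (ENNReal.div_ne_top hfin hS0), ENNReal.div_mul_cancel hS0 hSt]
      exact h3
  have hpt (y : E) : u y ^ p ≤ (K * (lam ^ (2 - p) * A)) ^ (p / 2) := by
    have h1 := h (S ∪ T) (hS.union hTm) ((measure_union_le _ _).trans (by
      rw [two_mul]; gcongr)) y
    have h2 : ∫⁻ x in (S ∪ T)ᶜ, u x ^ 2 ∂μ ≤ lam ^ (2 - p) * A := by
      calc _ ≤ ∫⁻ x in (S ∪ T)ᶜ, lam ^ (2 - p) * u x ^ p ∂μ := by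
            refine setLIntegral_mono' (hS.union hTm).compl fun x hx => ?_
            have hx' : u x ≤ lam := by
              by_contra hlt
              exact hx (Or.inr ⟨not_le.mp hlt, fun hxS => hx (Or.inl hxS)⟩)
            calc u x ^ 2 = u x ^ ((2 - p) + p) := by
                  rw [sub_add_cancel, ENNReal.rpow_two]
              _ = u x ^ (2 - p) * u x ^ p :=
                  ENNReal.rpow_add_of_nonneg _ _ (by linarith) hp.le
              _ ≤ _ := by
                  gcongr
        _ ≤ ∫⁻ x in Sᶜ, lam ^ (2 - p) * u x ^ p ∂μ :=
            lintegral_mono_set (Set.compl_subset_compl.mpr Set.subset_union_left)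
        _ = _ := lintegral_const_mul _ hum
    calc u y ^ p = (u y ^ 2) ^ (p / 2) := by
          rw [← ENNReal.rpow_two, ← ENNReal.rpow_mul]
          congr 1
          ring
      _ ≤ _ := by
          gcongr
          exact h1.trans (by gcongr)
  calc ∫⁻ x in S, u x ^ p ∂μ ≤ ∫⁻ _ in S, (K * (lam ^ (2 - p) * A)) ^ (p / 2) ∂μ :=
        lintegral_mono fun y => hpt y
    _ = K ^ (p / 2) * (lam ^ p) ^ ((2 - p) / 2) * A ^ (p / 2) * μ S := by
        rw [setLIntegral_const, ENNReal.mul_rpow_of_nonneg _ _ (by positivity),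
          ENNReal.mul_rpow_of_nonneg _ _ (by positivity), ← ENNReal.rpow_mul, ← ENNReal.rpow_mul,
          ← mul_assoc, show (2 - p) * (p / 2) = p * ((2 - p) / 2) by ring]
    _ = K ^ (p / 2) * (A ^ ((2 - p) / 2) * A ^ (p / 2)) *
          ((μ S)⁻¹ ^ ((2 - p) / 2) * μ S) := by
        rw [hlamp, div_eq_mul_inv A, ENNReal.mul_rpow_of_nonneg _ _ (by linarith)]
        ring
    _ = K ^ (p / 2) * A * μ S ^ (p / 2) := by
        rw [← ENNReal.rpow_add_of_nonneg _ _ (by linarith) (by linarith),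
          show (2 - p) / 2 + p / 2 = 1 by ring, ENNReal.rpow_one]
        congr 1
        rw [ENNReal.inv_rpow, ← ENNReal.rpow_neg]
        nth_rw 2 [← ENNReal.rpow_one (μ S)]
        rw [← ENNReal.rpow_add _ _ hS0 hSt]
        congr 1
        ring
    _ = _ := by
        rw [ENNReal.mul_rpow_of_nonneg _ _ (by positivity)]
        ring

/-- The uncertainty principle in `L^p` for transforms of integrable functions. -/
lemma exists_lintegral_rpow_fourier_le (d : ℕ) [NeZero d] :
    ∃ C : ℝ, 1 ≤ C ∧ ∀ S Sig : Set (EuclideanSpace ℝ (Fin d)), MeasurableSet S →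
      volume S * volume Sig ≠ ∞ → ∀ p : ℝ, 0 < p → p < 2 →
      ∀ F : EuclideanSpace ℝ (Fin d) → ℂ, Integrable F → (∀ᵐ x, x ∉ Sig → F x = 0) →
        ∫⁻ x in Sᶜ, ‖𝓕 F x‖ₑ ^ p ≠ ∞ →
        ∫⁻ x, ‖𝓕 F x‖ₑ ^ p ≤ ENNReal.ofReal
          (C * Real.exp (C * p * (volume S * volume Sig).toReal)) *
            ∫⁻ x in Sᶜ, ‖𝓕 F x‖ₑ ^ p := by
  obtain ⟨K, hK, hmain⟩ := exists_sq_enorm_fourier_le_setLIntegral d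
  refine ⟨2 + 2 * K, by linarith, fun S Sig hS hSS p hp hp2 F hF hFS hfin => ?_⟩
  have hcont : Continuous (𝓕 F) := VectorFourier.fourierIntegral_continuous
    Real.continuous_fourierChar continuous_inner hF
  set t := (volume S * volume Sig).toReal with ht
  have ht0 : 0 ≤ t := ENNReal.toReal_nonneg
  set A := ∫⁻ x in Sᶜ, ‖𝓕 F x‖ₑ ^ p with hA
  suffices hle : ∫⁻ x in S, ‖𝓕 F x‖ₑ ^ p ≤ ENNReal.ofReal (Real.exp (2 * K * p * t)) * A by
    rw [← lintegral_add_compl _ hS]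
    calc _ ≤ ENNReal.ofReal (Real.exp (2 * K * p * t)) * A + ENNReal.ofReal 1 * A := by
          rw [ENNReal.ofReal_one, one_mul]
          gcongr
      _ = ENNReal.ofReal (Real.exp (2 * K * p * t) + 1) * A := by
          rw [ENNReal.ofReal_add (by positivity) zero_le_one, add_mul]
      _ ≤ _ := by
          refine mul_le_mul' (ENNReal.ofReal_le_ofReal ?_) le_rfl
          have h1 : 1 ≤ Real.exp ((2 + 2 * K) * p * t) := Real.one_le_exp (by positivity)
          have h2 : Real.exp (2 * K * p * t) ≤ Real.exp ((2 + 2 * K) * p * t) := by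
            gcongr
            linarith
          nlinarith
  rcases eq_or_ne (volume S) 0 with hS0 | hS0
  · rw [setLIntegral_measure_zero _ _ hS0]
    exact zero_le
  rcases eq_or_ne (volume Sig) 0 with hSig0 | hSig0
  · have hF0 : F =ᵐ[volume] 0 := by
      have h1 : ∀ᵐ x, x ∉ Sig := measure_eq_zero_iff_ae_notMem.mp hSig0
      filter_upwards [h1, hFS] with x hx hx'
      exact hx' hx
    have h0 (x : EuclideanSpace ℝ (Fin d)) : 𝓕 F x = 0 := by
      rw [Real.fourier_eq]
      refine integral_eq_zero_of_ae ?_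
      filter_upwards [hF0] with v hv
      simp [hv]
    simp [h0, hp]
  have hSt : volume S ≠ ∞ := fun h => hSS (by rw [h, ENNReal.top_mul hSig0])
  have hSigt : volume Sig ≠ ∞ := fun h => hSS (by rw [h, ENNReal.mul_top hS0])
  set m := (volume S).toReal with hm
  set σ := (volume Sig).toReal with hσ
  have hm0 : 0 < m := ENNReal.toReal_pos hS0 hSt
  have hσ0 : 0 < σ := ENNReal.toReal_pos hSig0 hSigt
  have htm : t = m * σ := ENNReal.toReal_mul
  have hSm : volume S = ENNReal.ofReal m := (ENNReal.ofReal_toReal hSt).symm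
  refine (setLIntegral_rpow_le_of_sq_le hcont.measurable.enorm hS hS0 hSt hp hp2 hfin
    fun S' hS' hS'2 y => hmain F hF Sig σ hσ0 (ENNReal.ofReal_toReal hSigt).symm hFS S' (2 * m) hS'
      (by positivity) ?_ y).trans ?_
  · rwa [ENNReal.ofReal_mul zero_le_two, ← hSm, ENNReal.ofReal_ofNat]
  · refine mul_le_mul' ?_ le_rfl
    rw [hSm, ← ENNReal.ofReal_mul (by positivity), ENNReal.ofReal_rpow_of_nonneg (by positivity)
      (by positivity)]
    refine ENNReal.ofReal_le_ofReal ?_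
    -- The factor $K\sigma m=Kt$ is absorbed by $x\le e^x$, so the $p/2$ power is a pure exponential
    -- in $pt$.
    have h1 : K * σ * Real.exp (K * (2 * m * σ)) * m ≤ Real.exp (4 * K * t) := by
      have h2 : K * t ≤ Real.exp (K * t) := by linarith [Real.add_one_le_exp (K * t)]
      calc _ = (K * t) * Real.exp (2 * (K * t)) := by rw [htm]; ring_nf
        _ ≤ Real.exp (K * t) * Real.exp (2 * (K * t)) := by gcongr
        _ = Real.exp (3 * (K * t)) := by rw [← Real.exp_add]; ring_nf
        _ ≤ _ := by
          have : 0 ≤ K * t := by positivity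
          exact Real.exp_le_exp.mpr (by linarith)
    calc _ ≤ Real.exp (4 * K * t) ^ (p / 2) :=
          Real.rpow_le_rpow (by positivity) h1 (by positivity)
      _ = _ := by
          rw [← Real.exp_mul]
          ring_nf

theorem mainTheorem4 (d : ℕ) (hd : 0 < d) :
    ∃ C : ℝ, 0 < C ∧
      ∀ S Sig : Set (EuclideanSpace ℝ (Fin d)),
        NullMeasurableSet S volume → NullMeasurableSet Sig volume →
        volume S * volume Sig ≠ ∞ →
        ∀ p : ℝ, 0 < p → p < 2 →
          ∀ f : EuclideanSpace ℝ (Fin d) → ℂ,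
            MemLp f (ENNReal.ofReal p) volume → HasSpectrumIn f Sig →
            ∫ x, ‖f x‖ ^ p ≤
              C * Real.exp (C * p * (volume S * volume Sig).toReal) *
                ∫ x in Sᶜ, ‖f x‖ ^ p := by
  have : NeZero d := ⟨hd.ne'⟩
  obtain ⟨C, hC, hmain⟩ := exists_lintegral_rpow_fourier_le d
  refine ⟨C, by linarith, fun S Sig hS _ hSS p hp hp2 f hf hfS => ?_⟩
  have hint : Integrable fun x => ‖f x‖ ^ p := by
    have := hf.integrable_norm_rpow (by simpa using hp) ENNReal.ofReal_ne_top
    rwa [ENNReal.toReal_ofReal hp.le] at this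
  -- Treated apart because `Sig` may then have infinite measure.
  rcases eq_or_ne (volume S) 0 with hS0 | hS0
  · have hSc : (Sᶜ : Set (EuclideanSpace ℝ (Fin d))) =ᵐ[volume] Set.univ := by
      rw [ae_eq_univ, compl_compl]
      exact hS0
    rw [setIntegral_congr_set hSc, setIntegral_univ, hS0, zero_mul, ENNReal.toReal_zero, mul_zero,
      Real.exp_zero, mul_one]
    exact le_mul_of_one_le_left (integral_nonneg fun x => by positivity) hC
  have hSig : volume Sig ≠ ∞ := fun h => hSS (by rw [h, ENNReal.mul_top hS0])
  obtain ⟨F, hF, hFS, hfF⟩ := hfS.exists_ae_eq_fourier hSig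
  obtain ⟨S₁, -, hS₁, hSS₁⟩ := hS.exists_measurable_superset_ae_eq
  have hvol : volume S₁ = volume S := measure_congr hSS₁
  have hconv (R : Set (EuclideanSpace ℝ (Fin d))) :
      ENNReal.ofReal (∫ x in R, ‖f x‖ ^ p) = ∫⁻ x in R, ‖𝓕 F x‖ₑ ^ p := by
    rw [ofReal_integral_eq_lintegral_ofReal hint.integrableOn
      (Filter.Eventually.of_forall fun x => by positivity)]
    refine lintegral_congr_ae (ae_restrict_of_ae ?_)
    filter_upwards [hfF] with x hx
    rw [← hx, ← ENNReal.ofReal_rpow_of_nonneg (norm_nonneg _) hp.le, ofReal_norm]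
  have h := hmain S₁ Sig hS₁ (by rwa [hvol]) p hp hp2 F hF hFS
    (by rw [← hconv]; exact ENNReal.ofReal_ne_top)
  rw [← setLIntegral_univ, ← hconv, ← hconv, ← ENNReal.ofReal_mul (by positivity), hvol,
    setIntegral_univ, setIntegral_congr_set hSS₁.compl] at h
  refine (ENNReal.ofReal_le_ofReal_iff ?_).mp h
  exact mul_nonneg (by positivity) (integral_nonneg fun x => by positivity)
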